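/- Let $A\in\mathbb R^{n\times n}$, $B\in\mathbb R^{n\times m}$, let $Q\in\mathbb R^{n\times n}$ be symmetric positive semidefinite and $R\in\mathbb R^{m\times m}$ symmetric positive definite. Suppose that $(A,B)$ is controllable and $(A,Q^{1/2})$ is detectable. Consider the system $$\dot x(t)=Ax(t)+Bu(t)\qquad(1)$$ and the cost $$J(u,x)=\int_0^\infty\bigl(x(t)^\top Qx(t)+u(t)^\top Ru(t)\bigr)\,dt .\qquad(2)$$ **Data.** Let $N\in\mathbb N$ and let $T>0$ be such that $T\neq 2\pi k/|\operatorname{Im}(\lambda_i-\lambda_j)|$ for every $k\in\mathbb Z$ and all eigenvalues $\lambda_i,\lambda_j$ of $A$ with $\operatorname{Im}(\lambda_i-\lambda_j)\ne0$. Let $u:[0,NT]\to\mathbb R^m$ be a piecewise constant persistently exciting input of order $n+1$: there are $\mu_0,\dots,\mu_{N-1}\in\mathbb R^m$ with $u(t+iT)=\mu_i$ for $0\le t<T$, $i=0,\dots,N-1$, such that $n+1\le N$ and the block Hankel matrix $(\mu_{i+j})_{0\le i\le n,\ 0\le j\le N-n-1}$ has rank $m(n+1)$. Let $x:[0,NT]\to\mathbb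 R^n$ be a corresponding state trajectory of (1). For $t\in[0,T]$ put $$\mathcal H_T(x(t))=[\,x(t)\ \ x(t+T)\ \cdots\ x(t+(N-1)T)\,],\qquad \mathcal H_T(\dot x(t))=[\,\dot x(t)\ \ \dot x(t+T)\ \cdots\ \dot x(t+(N-1)T)\,],$$ and $\mathcal H_T(u)=[\,\mu_0\ \ \mu_1\ \cdots\ \mu_{N-1}\,]$; here the entry $\dot x(t+jT)$ is the derivative of $x$ restricted to $[jT,(j+1)T]$ (hence one-sided if $t=0$ or $t=T$). **Design.** Fix $t\in[0,T]$ and, for symmetric $P\in\mathbb R^{n\times n}$, let $$\mathcal L(P)=\mathcal H_T(x(t))^\top Q\,\mathcal H_T(x(t))+\mathcal H_T(u)^\top R\,\mathcal H_T(u)+\mathcal H_T(x(t))^\top P\,\mathcal H_T(\dot x(t))+\mathcal H_T(\dot x(t))^\top P\,\mathcal H_T(x(t)).$$ Let $P^*$ be a solution of the problem of maximizing $\operatorname{tr}(P)$ subject to $P\succ0$ and $\mathcal L(P)\succeq0$, and let $\Gamma\in\mathbb R^{N\times n}$ satisfy $$\begin{bmatrix}\mathcal H_T(x(t))\\ \mathcal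 L(P^*)\end{bmatrix}\Gamma=\begin{bmatrix}I\\0\end{bmatrix}.$$ **Conclusion.** The matrix $K=-\mathcal H_T(u)\,\Gamma$ is the unique solution of the LQR problem for (1) and (2). That is, for every initial state $x_0\in\mathbb R^n$ the feedback $u=-Kx$ yields a finite cost (2) and minimizes it over all locally integrable inputs $u:[0,\infty)\to\mathbb R^m$, with $x$ the resulting state from $x(0)=x_0$; it is the only minimizing input, up to equality almost everywhere; and $K$ is the only gain whose feedback is optimal for every initial state. -/

import Mathlib

open scoped ENNReal

noncomputable section

namespace DataLQR

variable {n m σ p : ℕ}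

/-- `lam` is an eigenvalue of the real matrix `A`, regarded as a complex matrix. -/
def IsEigenvalue (A : Matrix (Fin n) (Fin n) ℝ) (lam : ℂ) : Prop :=
  Module.End.HasEigenvalue (Matrix.toLin' (A.map (algebraMap ℝ ℂ))) lam

/-- All eigenvalues of `A` have negative real part. -/
def IsHurwitz (A : Matrix (Fin n) (Fin n) ℝ) : Prop :=
  ∀ lam : ℂ, IsEigenvalue A lam → lam.re < 0

/-- The controllability matrix `[B, A B, …, A ^ (n - 1) B]`. -/
def controllabilityMatrix (A : Matrix (Fin n) (Fin n) ℝ) (B : Matrix (Fin n) (Fin m) ℝ) :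
    Matrix (Fin n) (Fin n × Fin m) ℝ :=
  Matrix.of fun i kj => (A ^ (kj.1 : ℕ) * B) i kj.2

/-- The pair `(A, B)` is controllable. -/
def IsControllable (A : Matrix (Fin n) (Fin n) ℝ) (B : Matrix (Fin n) (Fin m) ℝ) : Prop :=
  (controllabilityMatrix A B).rank = n

/-- The pair `(A, C)` is detectable: some output injection makes `A - F C` Hurwitz. -/
def IsDetectable (A : Matrix (Fin n) (Fin n) ℝ) (C : Matrix (Fin p) (Fin n) ℝ) : Prop :=
  ∃ F : Matrix (Fin n) (Fin p) ℝ, IsHurwitz (A - F * C)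

section Sqrt
open scoped MatrixOrder

/-- The positive semidefinite square root `Q ^ (1/2)` of a positive semidefinite matrix. -/
def matrixSqrt (Q : Matrix (Fin n) (Fin n) ℝ) : Matrix (Fin n) (Fin n) ℝ := CFC.sqrt Q

theorem matrixSqrt_posSemidef (Q : Matrix (Fin n) (Fin n) ℝ) : (matrixSqrt Q).PosSemidef :=
  Matrix.nonneg_iff_posSemidef.mp (CFC.sqrt_nonneg Q)

theorem matrixSqrt_mul_self {Q : Matrix (Fin n) (Fin n) ℝ} (hQ : Q.PosSemidef) :
    matrixSqrt Q * matrixSqrt Q = Q :=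
  CFC.sqrt_mul_sqrt_self Q (Matrix.nonneg_iff_posSemidef.mpr hQ)

end Sqrt

/-- On `[0, τ]`, the signal `x` is the state of `ẋ = A x + B u` under the integrable input `u`
(solution in the sense of Carathéodory, i.e. of the integral equation). -/
structure IsTrajectoryOn (A : Matrix (Fin n) (Fin n) ℝ) (B : Matrix (Fin n) (Fin m) ℝ)
    (τ : ℝ) (u : ℝ → Fin m → ℝ) (x : ℝ → Fin n → ℝ) : Prop where
  integrableOn_input : MeasureTheory.IntegrableOn u (Set.Icc 0 τ)
  continuousOn_state : ContinuousOn x (Set.Icc 0 τ)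
  state_eq : ∀ t ∈ Set.Icc 0 τ,
    x t = x 0 + ∫ s in (0 : ℝ)..t, (A.mulVec (x s) + B.mulVec (u s))

/-- The sampling period `T` is nonpathological for `A`: `T ≠ 2πk / |Im (λ₁ - λ₂)|` for all
integers `k` and all eigenvalues `λ₁`, `λ₂` for which the denominator does not vanish. -/
def IsAdmissiblePeriod (A : Matrix (Fin n) (Fin n) ℝ) (T : ℝ) : Prop :=
  ∀ lam₁ lam₂ : ℂ, IsEigenvalue A lam₁ → IsEigenvalue A lam₂ → (lam₁ - lam₂).im ≠ 0 →
    ∀ k : ℤ, T ≠ 2 * Real.pi * k / |(lam₁ - lam₂).im|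

/-- The block Hankel matrix of depth `L` of `μ 0, …, μ (N - 1)`: its block in row `i < L` and
column `j ≤ N - L` is `μ (i + j)`. -/
def blockHankel (N L : ℕ) (μ : ℕ → Fin m → ℝ) :
    Matrix (Fin L × Fin m) (Fin (N + 1 - L)) ℝ :=
  Matrix.of fun ia j => μ ((ia.1 : ℕ) + (j : ℕ)) ia.2

/-- `u` is, on `[0, NT)`, a piecewise constant persistently exciting input of order `L` for a
system with state matrix `A`. -/
structure IsPCPE (A : Matrix (Fin n) (Fin n) ℝ) (T : ℝ) (N L : ℕ) (u : ℝ → Fin m → ℝ) :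
    Prop where
  period_pos : 0 < T
  period_admissible : IsAdmissiblePeriod A T
  order_le : L ≤ N
  exists_values : ∃ μ : ℕ → Fin m → ℝ,
    (∀ i : ℕ, i < N → ∀ t ∈ Set.Ico 0 T, u (t + i * T) = μ i) ∧
    (blockHankel N L μ).rank = m * L

/-- `[ξ(t), ξ(t + T), …, ξ(t + (N - 1) T)]`. -/
def hankelRow (T : ℝ) (N : ℕ) (ξ : ℝ → Fin σ → ℝ) (t : ℝ) : Matrix (Fin σ) (Fin N) ℝ :=
  Matrix.of fun i j => ξ (t + (j : ℕ) * T) i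

/-- The constant (in `t ∈ [0, T)`) value of the data matrix of an input which is constant on each
`[iT, (i + 1)T)`. -/
def inputData (T : ℝ) (N : ℕ) (u : ℝ → Fin m → ℝ) : Matrix (Fin m) (Fin N) ℝ :=
  hankelRow T N u 0

/-- `[ẋ(t), ẋ(t + T), …, ẋ(t + (N - 1) T)]` for `t ∈ [0, T]`. The input may jump at multiples of
`T`, so column `j` is the derivative of `x` within `[jT, (j + 1)T]`: the usual derivative if
`0 < t < T`, the right derivative if `t = 0`, the left derivative if `t = T`. -/
def derivData (T : ℝ) (N : ℕ) (x : ℝ → Fin n → ℝ) (t : ℝ) : Matrix (Fin n) (Fin N) ℝ :=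
  Matrix.of fun i j =>
    derivWithin x (Set.Icc ((j : ℕ) * T) (((j : ℕ) + 1) * T)) (t + (j : ℕ) * T) i

/-- The data-based matrix `𝓛(P)`. -/
def dataLMI (Q : Matrix (Fin n) (Fin n) ℝ) (R : Matrix (Fin m) (Fin m) ℝ) (T : ℝ) (N : ℕ)
    (u : ℝ → Fin m → ℝ) (x : ℝ → Fin n → ℝ) (t : ℝ) (P : Matrix (Fin n) (Fin n) ℝ) :
    Matrix (Fin N) (Fin N) ℝ :=
  (hankelRow T N x t).transpose * Q * hankelRow T N x t
    + (inputData T N u).transpose * R * inputData T N u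
    + (hankelRow T N x t).transpose * P * derivData T N x t
    + (derivData T N x t).transpose * P * hankelRow T N x t

/-- The constraint set `P ≻ 0`, `𝓛(P) ⪰ 0`. -/
def feasibleSet (Q : Matrix (Fin n) (Fin n) ℝ) (R : Matrix (Fin m) (Fin m) ℝ) (T : ℝ) (N : ℕ)
    (u : ℝ → Fin m → ℝ) (x : ℝ → Fin n → ℝ) (t : ℝ) : Set (Matrix (Fin n) (Fin n) ℝ) :=
  {P | P.PosDef ∧ (dataLMI Q R T N u x t P).PosSemidef}

/-- `P` maximizes the trace over the constraint set. -/
def IsTraceMaximizer (Q : Matrix (Fin n) (Fin n) ℝ) (R : Matrix (Fin m) (Fin m) ℝ) (T : ℝ)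
    (N : ℕ) (u : ℝ → Fin m → ℝ) (x : ℝ → Fin n → ℝ) (t : ℝ)
    (P : Matrix (Fin n) (Fin n) ℝ) : Prop :=
  P ∈ feasibleSet Q R T N u x t ∧ IsMaxOn Matrix.trace (feasibleSet Q R T N u x t) P

/-- `∫₀^∞ (xᵀ Q x + uᵀ R u) dt`, with values in `[0, ∞]`. -/
def lqrCost (Q : Matrix (Fin n) (Fin n) ℝ) (R : Matrix (Fin m) (Fin m) ℝ)
    (u : ℝ → Fin m → ℝ) (x : ℝ → Fin n → ℝ) : ℝ≥0∞ :=
  ∫⁻ t in Set.Ioi (0 : ℝ),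
    ENNReal.ofReal (dotProduct (x t) (Q.mulVec (x t)) + dotProduct (u t) (R.mulVec (u t)))

/-- `u` is a locally integrable input on `[0, ∞)`, and `x` the state it produces from `x₀`. -/
def IsAdmissible (A : Matrix (Fin n) (Fin n) ℝ) (B : Matrix (Fin n) (Fin m) ℝ)
    (x₀ : Fin n → ℝ) (u : ℝ → Fin m → ℝ) (x : ℝ → Fin n → ℝ) : Prop :=
  x 0 = x₀ ∧ ∀ τ : ℝ, 0 ≤ τ → IsTrajectoryOn A B τ u x

/-- The input `u`, with state `x`, has finite cost and minimizes the cost among all inputs, for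
the initial state `x₀`. -/
def IsOptimal (A : Matrix (Fin n) (Fin n) ℝ) (B : Matrix (Fin n) (Fin m) ℝ)
    (Q : Matrix (Fin n) (Fin n) ℝ) (R : Matrix (Fin m) (Fin m) ℝ)
    (x₀ : Fin n → ℝ) (u : ℝ → Fin m → ℝ) (x : ℝ → Fin n → ℝ) : Prop :=
  IsAdmissible A B x₀ u x ∧ lqrCost Q R u x < ∞ ∧
    ∀ u' x', IsAdmissible A B x₀ u' x' → lqrCost Q R u x ≤ lqrCost Q R u' x'

/-- For every initial state, the feedback `u = -K x` is an optimal input. -/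
def IsLQRGain (A : Matrix (Fin n) (Fin n) ℝ) (B : Matrix (Fin n) (Fin m) ℝ)
    (Q : Matrix (Fin n) (Fin n) ℝ) (R : Matrix (Fin m) (Fin m) ℝ)
    (K : Matrix (Fin m) (Fin n) ℝ) : Prop :=
  ∀ x₀ : Fin n → ℝ, ∃ x : ℝ → Fin n → ℝ, IsOptimal A B Q R x₀ (fun t => -K.mulVec (x t)) x

/-- For every initial state, the feedback `u = -K x` is the only optimal input (inputs being
identified when they agree almost everywhere on `[0, ∞)`), and `K` is the only gain whose feedback
is optimal for every initial state. -/
def IsUniqueLQRSolution (A : Matrix (Fin n) (Fin n) ℝ) (B : Matrix (Fin n) (Fin m) ℝ)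
    (Q : Matrix (Fin n) (Fin n) ℝ) (R : Matrix (Fin m) (Fin m) ℝ)
    (K : Matrix (Fin m) (Fin n) ℝ) : Prop :=
  (∀ x₀ : Fin n → ℝ, ∃ x : ℝ → Fin n → ℝ,
    IsOptimal A B Q R x₀ (fun t => -K.mulVec (x t)) x ∧
    ∀ u' x', IsOptimal A B Q R x₀ u' x' →
      (∀ t : ℝ, 0 ≤ t → x' t = x t) ∧
      u' =ᵐ[MeasureTheory.volume.restrict (Set.Ioi (0 : ℝ))] fun t => -K.mulVec (x t)) ∧
  ∀ K' : Matrix (Fin m) (Fin n) ℝ, IsLQRGain A B Q R K' → K' = K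

end DataLQR

end

open scoped ENNReal

namespace DataLQR

/-! ### Linear differential equations with constant coefficients. -/

section LinearODE

open scoped Matrix.Norms.Operator
open Set Filter Topology

variable {ι : Type*} [Fintype ι] [DecidableEq ι]

/-! Write X and U for the state and input data and G = UΓ, so that K = -G. The derivative data equal
AX + BU, hence with XΓ = I the equation 𝓛(P)Γ = 0 reads Xᵀ(Q + P(A + BG) + AᵀP) + Uᵀ(RG + BᵀP) = 0.
If the stacked matrix [X; U] has full row rank, both brackets vanish (`riccati_of_data`): RK = BᵀP
and Q + PA + AᵀP = PBK, the algebraic Riccati equation together with its gain.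

Full row rank (`eq_zero_of_vecMul_data_eq_zero`) comes from Willems' lemma for the sampled system,
proved with Cayley–Hamilton in `eq_zero_of_dotProduct_data_eq_zero`. It needs the sampled pair to be
controllable, which is `IsControllable.sampled`: for an admissible period an eigenvector of the
sampled exponential is an eigenvector of the generator, so the Hautus test carries over. The data at
offset t and at offset 0 differ by an invertible exponential.

Optimality (`isUniqueLQRSolution_of_riccati`) is completion of squares: the cost on [0, τ] is x₀ᵀPx₀
- x(τ)ᵀPx(τ) plus the integral of (u + Kx)ᵀR(u + Kx). Positive semidefiniteness of P bounds the
feedback cost by x₀ᵀPx₀. For the reverse inequality the terminal term must become small, and for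
this detectability is used: a quadratic storage function (`IsDetectable.exists_storage`) shows that
a trajectory of finite cost is near 0 at arbitrarily late times. An input attaining the value has
zero residual almost everywhere, so it is the feedback. -/

theorem hasDerivWithinAt_of_eq_integral {E : Type*} [NormedAddCommGroup E] [NormedSpace ℝ E]
    [CompleteSpace E] {y f : ℝ → E} {a b : ℝ} (hf : ContinuousOn f (Icc a b))
    (hy : ∀ t ∈ Icc a b, y t = y a + ∫ s in a..t, f s) {t : ℝ} (ht : t ∈ Icc a b) :
    HasDerivWithinAt y (f t) (Icc a b) t := by
  have hab : a ≤ b := ht.1.trans ht.2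
  -- Extending `f` by its endpoint values gives a function continuous on all of ℝ, so the two-sided
  -- fundamental theorem applies at the endpoints too.
  set g : ℝ → E := IccExtend hab ((Icc a b).domRestrict f) with hg
  have hgc : Continuous g := (continuousOn_iff_continuous_domRestrict.mp hf).Icc_extend'
  have hgf : ∀ s ∈ Icc a b, g s = f s := fun s hs => by
    rw [hg, IccExtend_of_mem _ _ hs, domRestrict_apply]
  have hd : HasDerivAt (fun r => y a + ∫ s in a..r, g s) (g t) t :=
    (hgc.integral_hasStrictDerivAt a t).hasDerivAt.const_add _
  rw [← hgf t ht]
  refine hd.hasDerivWithinAt.congr (fun r hr => ?_) ?_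
  · rw [hy r hr, intervalIntegral.integral_congr fun s hs => (hgf s ?_).symm]
    rw [uIcc_of_le hr.1] at hs
    exact ⟨hs.1, hs.2.trans hr.2⟩
  · rw [hy t ht, intervalIntegral.integral_congr fun s hs => (hgf s ?_).symm]
    rw [uIcc_of_le ht.1] at hs
    exact ⟨hs.1, hs.2.trans ht.2⟩

theorem hasDerivAt_exp_smul_mulVec (M : Matrix ι ι ℝ) (v : ι → ℝ) (t : ℝ) :
    HasDerivAt (fun s : ℝ => (NormedSpace.exp (s • M)).mulVec v)
      (M.mulVec ((NormedSpace.exp (t • M)).mulVec v)) t := by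
  have h := hasDerivAt_exp_smul_const' (𝕂 := ℝ) M t
  have := (LinearMap.toContinuousLinearMap
    ((Matrix.mulVecBilin ℝ ℝ).flip v)).hasFDerivAt.comp_hasDerivAt t h
  rw [Matrix.mulVec_mulVec]
  exact this

theorem eq_exp_smul_mulVec {M : Matrix ι ι ℝ} {z : ℝ → ι → ℝ} {a b : ℝ}
    (hz : ∀ t ∈ Icc a b, HasDerivWithinAt z (M.mulVec (z t)) (Icc a b) t) {t : ℝ}
    (ht : t ∈ Icc a b) : z t = (NormedSpace.exp ((t - a) • M)).mulVec (z a) := by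
  have he : ∀ s : ℝ, HasDerivAt (fun s : ℝ => (NormedSpace.exp ((s - a) • M)).mulVec (z a))
      (M.mulVec ((NormedSpace.exp ((s - a) • M)).mulVec (z a))) s := fun s =>
    (hasDerivAt_exp_smul_mulVec M (z a) (s - a)).comp_sub_const s a
  refine ODE_solution_unique (v := fun _ w => M.mulVec w)
    (K := ‖LinearMap.toContinuousLinearMap M.mulVecLin‖₊)
    (fun _ => (LinearMap.toContinuousLinearMap M.mulVecLin).lipschitz)
    (fun s hs => (hz s hs).continuousWithinAt) (fun s hs => ?_)
    (fun s _ => (he s).continuousAt.continuousWithinAt) (fun s _ => (he s).hasDerivWithinAt)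
    ?_ ht
  · exact (hz s (Ico_subset_Icc_self hs)).mono_of_mem_nhdsWithin
      (mem_of_superset (Icc_mem_nhdsGE hs.2) (Icc_subset_Icc_left hs.1))
  · simp

end LinearODE

/-! ### A quadratic Lyapunov function for a Hurwitz matrix. -/

section Lyapunov

open Polynomial
open scoped ComplexOrder

variable {ι : Type*} [Fintype ι] [DecidableEq ι]

/-- Young's inequality with weight `-lam.re`: the cross term costs half of the decay 2 Re λ |y|². -/
theorem two_mul_re_conj_mul_le {lam : ℂ} (hlam : lam.re < 0) (y v : ℂ) :
    2 * (star y * (lam * y + v)).re ≤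
      lam.re * Complex.normSq y + Complex.normSq v / (-lam.re) := by
  have hk : 0 < -lam.re := by linarith
  have h : 2 * (y.re * v.re + y.im * v.im) ≤
      -lam.re * Complex.normSq y + Complex.normSq v / (-lam.re) := by
    rw [← sub_nonneg]
    have : -lam.re * Complex.normSq y + Complex.normSq v / (-lam.re)
        - 2 * (y.re * v.re + y.im * v.im)
        = ((-lam.re * y.re - v.re) ^ 2 + (-lam.re * y.im - v.im) ^ 2) / (-lam.re) := by
      rw [Complex.normSq_apply, Complex.normSq_apply]
      have := hk.ne'
      have := hlam.ne
      field_simp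
      ring
    rw [this]
    positivity
  have e : (star y * (lam * y + v)).re =
      lam.re * Complex.normSq y + (y.re * v.re + y.im * v.im) := by
    simp [Complex.normSq_apply]
    ring
  rw [e]
  linarith

/-- A Lyapunov-type inequality for a product of linear factors with roots in the left half-plane;
for the characteristic polynomial the error term vanishes. -/
theorem exists_posSemidef_lyapunov_aeval (M : Matrix ι ι ℂ) (l : Multiset ℂ)
    (hl : ∀ a ∈ l, a.re < 0) :
    ∃ S : Matrix ι ι ℂ, S.PosSemidef ∧ ∃ c : ℝ, 0 ≤ c ∧ ∀ z : ι → ℂ,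
      2 * (star (S.mulVec z) ⬝ᵥ M.mulVec z).re ≤ -(∑ i, Complex.normSq (z i)) +
        c * ∑ i, Complex.normSq ((aeval M (l.map fun a => X - C a).prod).mulVec z i) := by
  induction l using Multiset.induction with
  | empty => exact ⟨0, Matrix.PosSemidef.zero, 1, zero_le_one, fun z => by simp⟩
  | cons a l ih =>
    obtain ⟨S, hS, c, hc, h⟩ := ih fun b hb => hl b (Multiset.mem_cons_of_mem hb)
    have ha : a.re < 0 := hl a (Multiset.mem_cons_self a l)
    set q : Matrix ι ι ℂ := aeval M (l.map fun a => X - C a).prod with hq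
    have hcomm : q * M = M * q := by
      have := (Commute.all (l.map fun a => X - C a).prod X).map (aeval M : ℂ[X] →ₐ[ℂ] _)
      simpa using this.eq
    have hq' : aeval M ((a ::ₘ l).map fun a => X - C a).prod = M * q - a • q := by
      simp [hq, sub_mul, Algebra.algebraMap_eq_smul_one]
    -- With y = qz one has qMz = ay + (M - a)y, so adding k q*q to S yields the decay k Re(a)|y|².
    -- This `k` makes it cancel the old error c|y|² exactly, leaving an error in (M - a)qz only.
    set k : ℝ := c / (-a.re) with hk
    have hk0 : 0 ≤ k := div_nonneg hc (by linarith)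
    refine ⟨S + (k : ℂ) • (q.conjTranspose * q), hS.add
      ((Matrix.posSemidef_conjTranspose_mul_self q).smul (by exact_mod_cast hk0)),
      k / (-a.re), div_nonneg hk0 (by linarith), fun z => ?_⟩
    have key : 2 * (star (((k : ℂ) • (q.conjTranspose * q)).mulVec z) ⬝ᵥ M.mulVec z).re ≤
        k * (a.re * ∑ i, Complex.normSq (q.mulVec z i) +
          (∑ i, Complex.normSq ((M * q - a • q).mulVec z i)) / (-a.re)) := by
      have e : star (((k : ℂ) • (q.conjTranspose * q)).mulVec z) ⬝ᵥ M.mulVec z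
          = (k : ℂ) * ∑ i, star (q.mulVec z i) *
            (a * q.mulVec z i + (M * q - a • q).mulVec z i) := by
        have e1 : ∀ i, a * q.mulVec z i + (M * q - a • q).mulVec z i
            = (q.mulVec (M.mulVec z)) i := by
          intro i
          rw [Matrix.mulVec_mulVec, hcomm, Matrix.sub_mulVec, Matrix.smul_mulVec]
          simp
        simp_rw [e1]
        rw [Matrix.smul_mulVec, star_smul, smul_dotProduct, ← Matrix.mulVec_mulVec,
          Matrix.star_mulVec, Matrix.conjTranspose_conjTranspose, ← Matrix.dotProduct_mulVec]
        simp [dotProduct]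
      rw [e, Complex.re_ofReal_mul, Complex.re_sum, mul_left_comm]
      refine mul_le_mul_of_nonneg_left ?_ hk0
      rw [Finset.mul_sum, Finset.mul_sum, Finset.sum_div, ← Finset.sum_add_distrib]
      exact Finset.sum_le_sum fun i _ => two_mul_re_conj_mul_le ha _ _
    have hka : k * a.re = -c := by
      rw [hk]; field_simp [ha.ne]
    rw [hq', Matrix.add_mulVec, star_add, add_dotProduct, Complex.add_re, mul_add]
    have := h z
    have e2 : k * (a.re * ∑ i, Complex.normSq (q.mulVec z i) +
          (∑ i, Complex.normSq ((M * q - a • q).mulVec z i)) / (-a.re)) =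
        -c * ∑ i, Complex.normSq (q.mulVec z i) +
        k / (-a.re) * ∑ i, Complex.normSq ((M * q - a • q).mulVec z i) := by
      rw [← hka]; ring
    linarith

theorem isRoot_charpoly_iff_isEigenvalue {n : ℕ} (A : Matrix (Fin n) (Fin n) ℝ) (lam : ℂ) :
    (A.map (algebraMap ℝ ℂ)).charpoly.IsRoot lam ↔ IsEigenvalue A lam := by
  rw [IsEigenvalue, Module.End.hasEigenvalue_iff_isRoot_charpoly, ← Matrix.charpoly_toLin']

/-- Taking all roots of the characteristic polynomial, Cayley–Hamilton removes the error term. The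
entrywise real part of the complex matrix gives the same quadratic inequality on real vectors. -/
theorem IsHurwitz.exists_lyapunov {n : ℕ} {A : Matrix (Fin n) (Fin n) ℝ} (hA : IsHurwitz A) :
    ∃ S : Matrix (Fin n) (Fin n) ℝ, S.PosSemidef ∧
      ∀ z : Fin n → ℝ, 2 * (S.mulVec z ⬝ᵥ A.mulVec z) ≤ -(z ⬝ᵥ z) := by
  set M := A.map (algebraMap ℝ ℂ) with hM
  obtain ⟨S, hS, c, -, h⟩ := exists_posSemidef_lyapunov_aeval M M.charpoly.roots fun a ha =>
    hA a ((isRoot_charpoly_iff_isEigenvalue A a).mp (isRoot_of_mem_roots ha))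
  have hp : (M.charpoly.roots.map fun a => X - C a).prod = M.charpoly :=
    ((IsAlgClosed.splits M.charpoly).eq_prod_roots_of_monic (Matrix.charpoly_monic M)).symm
  rw [hp, Matrix.aeval_self_charpoly] at h
  have hre : ∀ z : Fin n → ℝ, ∀ i,
      (S.mulVec (fun j => (z j : ℂ)) i).re = (S.map Complex.re).mulVec z i := fun z i => by
    simp [Matrix.mulVec, dotProduct]
  refine ⟨S.map Complex.re, Matrix.PosSemidef.of_dotProduct_mulVec_nonneg ?_ fun z => ?_,
    fun z => ?_⟩
  · ext i j
    have := congrArg Complex.re (hS.isHermitian.apply i j)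
    simpa using this
  · have := Complex.nonneg_iff.mp (hS.dotProduct_mulVec_nonneg fun j => (z j : ℂ))
    have h1 := this.1
    simp only [dotProduct, Complex.re_sum, Pi.star_apply, RCLike.star_def, Complex.conj_ofReal,
      Complex.re_ofReal_mul, hre] at h1
    simpa [dotProduct] using h1
  · have h1 := h fun j => (z j : ℂ)
    have hMz : M.mulVec (fun j => (z j : ℂ)) = fun i => ((A.mulVec z i : ℝ) : ℂ) := by
      ext i
      simp [hM, Matrix.mulVec, dotProduct]
    rw [hMz] at h1
    simp only [dotProduct, Complex.re_sum, Pi.star_apply, RCLike.star_def, Complex.re_mul_ofReal,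
      Complex.conj_re, hre, Complex.normSq_ofReal, Matrix.zero_mulVec, Pi.zero_apply, map_zero,
      Finset.sum_const_zero, mul_zero, add_zero] at h1
    simpa [dotProduct] using h1

end Lyapunov

/-! ### Eigenvectors of a matrix exponential. -/

section ExpEigenvectors

open scoped Matrix.Norms.Operator

variable {ι : Type*} [Fintype ι] [DecidableEq ι]

theorem exp_mulVec_of_mulVec_mulVec_eq_zero (G : Matrix ι ι ℂ) (y : ι → ℂ)
    (h : G.mulVec (G.mulVec y) = 0) : (NormedSpace.exp G).mulVec y = y + G.mulVec y := by
  have h1 := (NormedSpace.exp_series_hasSum_exp' (𝕂 := ℂ) G).map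
    ((Matrix.mulVecBilin ℂ ℂ).flip y) (LinearMap.continuous_of_finiteDimensional _)
  have h2 : HasSum (fun k : ℕ => ((k.factorial : ℂ)⁻¹ • G ^ k).mulVec y)
      (∑ k ∈ Finset.range 2, ((k.factorial : ℂ)⁻¹ • G ^ k).mulVec y) := by
    refine hasSum_sum_of_ne_finset_zero fun k hk => ?_
    obtain ⟨j, rfl⟩ := Nat.exists_eq_add_of_le (not_lt.mp fun h => hk (Finset.mem_range.mpr h))
    rw [Matrix.smul_mulVec, add_comm, pow_add, pow_two, ← Matrix.mulVec_mulVec,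
      ← Matrix.mulVec_mulVec, h, Matrix.mulVec_zero, smul_zero]
  have := HasSum.unique h1 h2
  simp only [Finset.sum_range_succ, Finset.sum_range_zero, Nat.factorial, Nat.cast_one, inv_one,
    one_smul, pow_zero, pow_one, Matrix.one_mulVec, zero_add, mul_one] at this
  exact this

theorem exp_smul_mulVec_of_sub_sq_eq_zero (M : Matrix ι ι ℂ) (lam T : ℂ) (y : ι → ℂ)
    (h : (M - lam • 1).mulVec ((M - lam • 1).mulVec y) = 0) :
    (NormedSpace.exp (T • M)).mulVec y
      = Complex.exp (T * lam) • (y + T • (M - lam • 1).mulVec y) := by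
  have e : T • M = (T * lam) • (1 : Matrix ι ι ℂ) + T • (M - lam • 1) := by
    rw [smul_sub, smul_smul]; abel
  have hs : NormedSpace.exp ((T * lam) • (1 : Matrix ι ι ℂ))
      = Complex.exp (T * lam) • (1 : Matrix ι ι ℂ) := by
    rw [← Algebra.algebraMap_eq_smul_one, ← Algebra.algebraMap_eq_smul_one, Complex.exp_eq_exp_ℂ]
    exact (NormedSpace.algebraMap_exp_comm (T * lam)).symm
  rw [e, Matrix.exp_add_of_commute _ _ ((Commute.one_left _).smul_left _), hs,
    ← Matrix.mulVec_mulVec, exp_mulVec_of_mulVec_mulVec_eq_zero, Matrix.smul_mulVec,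
    Matrix.one_mulVec, Matrix.smul_mulVec]
  rw [Matrix.smul_mulVec, Matrix.smul_mulVec, Matrix.mulVec_smul, h, smul_zero, smul_zero]

/-- If `exp (T ·)` separates the eigenvalues of `M`, then every eigenvector of `exp (T M)` is an
eigenvector of `M`. -/
theorem exists_mulVec_eq_smul_of_exp {M : Matrix ι ι ℂ} {T : ℂ} (hT : T ≠ 0)
    (hinj : ∀ a b : ℂ, Module.End.HasEigenvalue (Matrix.toLin' M) a →
      Module.End.HasEigenvalue (Matrix.toLin' M) b →
      Complex.exp (T * a) = Complex.exp (T * b) → a = b)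
    {w : ι → ℂ} (hw : w ≠ 0) {z : ℂ} (hz : (NormedSpace.exp (T • M)).mulVec w = z • w) :
    ∃ lam : ℂ, M.mulVec w = lam • w ∧ Module.End.HasEigenvalue (Matrix.toLin' M) lam := by
  -- This eigenspace is `M`-invariant, since `M` commutes with its exponential. The aim is that `M`
  -- acts on it as a scalar: a single eigenvalue and no Jordan block.
  set E := Module.End.eigenspace (Matrix.toLin' (NormedSpace.exp (T • M))) z with hE
  have memE : ∀ v, v ∈ E ↔ (NormedSpace.exp (T • M)).mulVec v = z • v := fun v => by
    rw [hE, Module.End.mem_eigenspace_iff, Matrix.toLin'_apply]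
  have hcomm : Commute M (NormedSpace.exp (T • M)) :=
    ((Commute.refl M).smul_right T).exp_right
  have hmaps : ∀ v ∈ E, Matrix.toLin' M v ∈ E := fun v hv => by
    rw [memE] at hv ⊢
    rw [Matrix.toLin'_apply, Matrix.mulVec_mulVec, ← hcomm.eq, ← Matrix.mulVec_mulVec, hv,
      Matrix.mulVec_smul]
  set f : Module.End ℂ E := (Matrix.toLin' M).restrict hmaps with hf
  have hfv : ∀ v : E, ((f v : E) : ι → ℂ) = M.mulVec v := fun v => by
    rw [hf, LinearMap.coe_restrict_apply, Matrix.toLin'_apply]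
  have hwE : w ∈ E := (memE w).mpr hz
  have : Nontrivial E := ⟨⟨⟨w, hwE⟩, 0, fun h => hw (congrArg Subtype.val h)⟩⟩
  have heig : ∀ mu, f.HasEigenvalue mu →
      Module.End.HasEigenvalue (Matrix.toLin' M) mu ∧ Complex.exp (T * mu) = z := by
    intro mu hmu
    obtain ⟨v, hv⟩ := hmu.exists_hasEigenvector
    have hv1 : M.mulVec (v : ι → ℂ) = mu • (v : ι → ℂ) := by
      rw [← hfv, hv.apply_eq_smul]; rfl
    have hv0 : (v : ι → ℂ) ≠ 0 := fun h => hv.2 (Subtype.ext h)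
    refine ⟨Module.End.hasEigenvalue_of_hasEigenvector
      (Module.End.hasEigenvector_iff.mpr ⟨Module.End.mem_eigenspace_iff.mpr ?_, hv0⟩), ?_⟩
    · rw [Matrix.toLin'_apply, hv1]
    · have h0 : (M - mu • 1).mulVec (v : ι → ℂ) = 0 := by
        rw [Matrix.sub_mulVec, hv1, Matrix.smul_mulVec, Matrix.one_mulVec, sub_self]
      have h1 := exp_smul_mulVec_of_sub_sq_eq_zero M mu T v (by rw [h0, Matrix.mulVec_zero])
      rw [(memE _).mp v.2, h0, smul_zero, add_zero] at h1
      exact (smul_left_injective ℂ hv0 h1).symm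
  obtain ⟨lam, hlam⟩ := Module.End.exists_eigenvalue f
  obtain ⟨hlamM, hlamz⟩ := heig lam hlam
  -- No Jordan block: on a vector killed by (M - λ)² the exponential is e^{Tλ}(1 + T(M - λ)), which
  -- can equal z = e^{Tλ} only if (M - λ)v = 0.
  have hsq : ∀ v : E, (f - lam • 1) ((f - lam • 1) v) = 0 → (f - lam • 1) v = 0 := by
    intro v hv
    have hc : ∀ u : E, (((f - lam • 1) u : E) : ι → ℂ) = (M - lam • 1).mulVec u := fun u => by
      rw [Matrix.sub_mulVec, Matrix.smul_mulVec, Matrix.one_mulVec, ← hfv]; rfl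
    have hv' : (M - lam • 1).mulVec ((M - lam • 1).mulVec (v : ι → ℂ)) = 0 := by
      rw [← hc, ← hc, hv]; rfl
    have h1 := exp_smul_mulVec_of_sub_sq_eq_zero M lam T v hv'
    rw [(memE _).mp v.2, hlamz, smul_add, left_eq_add, smul_smul] at h1
    refine Subtype.ext ?_
    rw [hc]
    refine (smul_eq_zero.mp h1).resolve_left (mul_ne_zero ?_ hT)
    rw [← hlamz]; exact Complex.exp_ne_zero _
  have hpow : ∀ k : ℕ, ∀ v : E, ((f - lam • 1) ^ k) v = 0 → (f - lam • 1) v = 0 := by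
    intro k
    induction k with
    | zero => intro v hv; rw [pow_zero, Module.End.one_apply] at hv; rw [hv, map_zero]
    | succ k ih =>
      intro v hv
      rw [pow_succ, Module.End.mul_apply] at hv
      exact hsq v (ih _ hv)
  have htop : (⊤ : Submodule ℂ E) ≤ f.eigenspace lam := by
    rw [← Module.End.iSup_maxGenEigenspace_eq_top f]
    refine iSup_le fun mu v hv => ?_
    by_cases hmu : f.HasEigenvalue mu
    · have : mu = lam := hinj _ _ (heig mu hmu).1 hlamM ((heig mu hmu).2.trans hlamz.symm)
      subst this
      obtain ⟨k, hk⟩ := (Module.End.mem_maxGenEigenspace f mu v).mp hv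
      have := hpow k v hk
      rw [Module.End.mem_eigenspace_iff]
      simpa [sub_eq_zero] using this
    · have hb : f.maxGenEigenspace mu = ⊥ := by
        by_contra hne
        exact hmu ((Module.End.hasUnifEigenvalue_iff_hasUnifEigenvalue_one
          (ENat.top_pos)).mp hne)
      rw [hb, Submodule.mem_bot] at hv
      rw [hv]; exact Submodule.zero_mem _
  refine ⟨lam, ?_, hlamM⟩
  have := Module.End.mem_eigenspace_iff.mp (htop (Submodule.mem_top (x := (⟨w, hwE⟩ : E))))
  rw [← hfv ⟨w, hwE⟩, this]; rfl

end ExpEigenvectors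

/-! ### Sampling, controllability and persistency of excitation. -/

section Sampling

open Matrix

variable {n m : ℕ}

theorem eq_zero_of_vecMul_eq_zero_of_rank {ι κ : Type*} [Fintype ι] [Fintype κ]
    {C : Matrix ι κ ℝ} (hC : C.rank = Fintype.card ι) {v : ι → ℝ} (h : v ᵥ* C = 0) : v = 0 := by
  have hli : LinearIndependent ℝ C.row := by
    rw [linearIndependent_iff_card_eq_finrank_span, ← hC, Matrix.rank_eq_finrank_span_row]
    rfl
  exact Matrix.vecMul_injective_iff.mpr hli (h.trans (Matrix.zero_vecMul C).symm)

theorem IsControllable.eq_zero_of_vecMul {A : Matrix (Fin n) (Fin n) ℝ}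
    {B : Matrix (Fin n) (Fin m) ℝ} (hAB : IsControllable A B) {v : Fin n → ℝ}
    (h : ∀ k, v ᵥ* (A ^ k * B) = 0) : v = 0 := by
  refine eq_zero_of_vecMul_eq_zero_of_rank (C := controllabilityMatrix A B)
    (by rw [Fintype.card_fin]; exact hAB) ?_
  ext ⟨k, j⟩
  exact congrFun (h k) j

/-- The matrix of the system `ẋ = A x + B u`, `u̇ = 0`. -/
def holdMatrix {𝕜 : Type*} [Zero 𝕜] (A : Matrix (Fin n) (Fin n) 𝕜) (B : Matrix (Fin n) (Fin m) 𝕜) :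
    Matrix (Fin n ⊕ Fin m) (Fin n ⊕ Fin m) 𝕜 :=
  fromBlocks A B 0 0

theorem vecMul_pow_mul_eq_zero {F : Matrix (Fin n) (Fin n) ℝ} {H : Matrix (Fin n) (Fin m) ℝ}
    {v : Fin n → ℝ} (h : ∀ k < n, v ᵥ* (F ^ k * H) = 0) (k : ℕ) : v ᵥ* (F ^ k * H) = 0 := by
  rcases Nat.eq_zero_or_pos n with rfl | hn
  · rw [Subsingleton.elim v 0, Matrix.zero_vecMul]
  have hdeg : F.charpoly.natDegree = n := by simp
  have hlt : ((Polynomial.X ^ k : Polynomial ℝ) %ₘ F.charpoly).natDegree < n := by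
    conv_rhs => rw [← hdeg]
    refine Polynomial.natDegree_modByMonic_lt _ F.charpoly_monic fun h1 => ?_
    rw [h1, Polynomial.natDegree_one] at hdeg
    omega
  rw [Matrix.pow_eq_aeval_mod_charpoly, Polynomial.aeval_eq_sum_range' hlt, Matrix.sum_mul,
    Matrix.vecMul_sum]
  refine Finset.sum_eq_zero fun i hi => ?_
  rw [Matrix.smul_mul, Matrix.vecMul_smul, h i (Finset.mem_range.mp hi), smul_zero]

theorem IsEigenvalue.conj {A : Matrix (Fin n) (Fin n) ℝ} {lam : ℂ} (h : IsEigenvalue A lam) :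
    IsEigenvalue A (star lam) := by
  rw [← isRoot_charpoly_iff_isEigenvalue] at h ⊢
  rw [Matrix.charpoly_map A (algebraMap ℝ ℂ)] at h ⊢
  rw [Polynomial.IsRoot, Polynomial.eval_map_algebraMap] at h ⊢
  have := congrArg star h
  rwa [star_zero, RCLike.star_def, ← Polynomial.aeval_conj] at this

theorem IsAdmissiblePeriod.eq_of_exp_eq {A : Matrix (Fin n) (Fin n) ℝ} {T : ℝ} (hT : 0 < T)
    (hA : IsAdmissiblePeriod A T) {a b : ℂ} (ha : IsEigenvalue A a) (hb : IsEigenvalue A b)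
    (h : Complex.exp (T * a) = Complex.exp (T * b)) : a = b := by
  obtain ⟨k, hk⟩ := Complex.exp_eq_exp_iff_exists_int.mp h
  have hre : T * a.re = T * b.re := by simpa using congrArg Complex.re hk
  have him : T * a.im = T * b.im + k * (2 * Real.pi) := by simpa using congrArg Complex.im hk
  by_cases hd : (a - b).im = 0
  · rw [Complex.sub_im, sub_eq_zero] at hd
    exact Complex.ext (mul_left_cancel₀ hT.ne' hre) hd
  · exfalso
    have hd' : a.im - b.im ≠ 0 := by rwa [Complex.sub_im] at hd
    rcases lt_or_gt_of_ne hd with hlt | hgt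
    · refine hA a b ha hb hd (-k) ?_
      rw [abs_of_neg hlt, Complex.sub_im, eq_div_iff (neg_ne_zero.mpr hd')]
      push_cast
      linarith
    · refine hA a b ha hb hd k ?_
      rw [abs_of_pos hgt, Complex.sub_im, eq_div_iff hd']
      linarith

/-- The hold matrix brings in the eigenvalue 0, which need not belong to `A`, while admissibility
concerns pairs of eigenvalues of `A`. As `A` is real, it can be applied to `a` and its conjugate,
whose exponentials are both 1; so `a` is real. -/
theorem IsAdmissiblePeriod.eq_zero_of_exp_eq_one {A : Matrix (Fin n) (Fin n) ℝ} {T : ℝ}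
    (hT : 0 < T) (hA : IsAdmissiblePeriod A T) {a : ℂ} (ha : IsEigenvalue A a)
    (h : Complex.exp (T * a) = 1) : a = 0 := by
  have hconj : Complex.exp (T * star a) = 1 := by
    have := congrArg (starRingEnd ℂ) h
    rwa [← Complex.exp_conj, map_mul, Complex.conj_ofReal, map_one] at this
  have hreal := hA.eq_of_exp_eq hT ha ha.conj (h.trans hconj.symm)
  have him : a.im = 0 := by
    have := congrArg Complex.im hreal
    simp at this
    linarith
  obtain ⟨k, hk⟩ := Complex.exp_eq_one_iff.mp h
  have hre : T * a.re = 0 := by simpa using congrArg Complex.re hk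
  exact Complex.ext ((mul_eq_zero.mp hre).resolve_left hT.ne') him

theorem hasEigenvalue_holdMatrix_transpose {A : Matrix (Fin n) (Fin n) ℝ}
    {B : Matrix (Fin n) (Fin m) ℂ} {a : ℂ}
    (h : Module.End.HasEigenvalue
      (Matrix.toLin' (holdMatrix (A.map (algebraMap ℝ ℂ)) B)ᵀ) a) :
    IsEigenvalue A a ∨ a = 0 := by
  rw [Module.End.hasEigenvalue_iff_isRoot_charpoly, Matrix.charpoly_toLin',
    Matrix.charpoly_transpose, holdMatrix, Matrix.charpoly_fromBlocks_zero₂₁,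
    Polynomial.root_mul] at h
  rcases h with h | h
  · exact Or.inl ((isRoot_charpoly_iff_isEigenvalue A a).mp h)
  · right
    rw [Matrix.charpoly_zero, Polynomial.IsRoot, Polynomial.eval_pow, Polynomial.eval_X] at h
    exact eq_zero_of_pow_eq_zero h

theorem IsAdmissiblePeriod.exp_injOn_holdMatrix {A : Matrix (Fin n) (Fin n) ℝ} {T : ℝ}
    (hT : 0 < T) (hA : IsAdmissiblePeriod A T) {a b : ℂ} (ha : IsEigenvalue A a ∨ a = 0)
    (hb : IsEigenvalue A b ∨ b = 0) (h : Complex.exp (T * a) = Complex.exp (T * b)) : a = b := by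
  rcases ha with ha | rfl
  · rcases hb with hb | rfl
    · exact hA.eq_of_exp_eq hT ha hb h
    · exact hA.eq_zero_of_exp_eq_one hT ha (by simpa using h)
  · rcases hb with hb | rfl
    · exact (hA.eq_zero_of_exp_eq_one hT hb (by simpa using h.symm)).symm
    · rfl

theorem exp_holdMatrix_map (A : Matrix (Fin n) (Fin n) ℝ) (B : Matrix (Fin n) (Fin m) ℝ) (T : ℝ) :
    (NormedSpace.exp (T • holdMatrix A B)).map (algebraMap ℝ ℂ) =
      NormedSpace.exp ((T : ℂ) • holdMatrix (A.map (algebraMap ℝ ℂ)) (B.map (algebraMap ℝ ℂ))) := by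
  open scoped Matrix.Norms.Operator in
  have h := NormedSpace.map_exp ((algebraMap ℝ ℂ).mapMatrix : Matrix (Fin n ⊕ Fin m) _ ℝ →+* _)
    (continuous_id.matrix_map Complex.continuous_ofReal) (T • holdMatrix A B)
  have e : (algebraMap ℝ ℂ).mapMatrix (T • holdMatrix A B) =
      (T : ℂ) • holdMatrix (A.map (algebraMap ℝ ℂ)) (B.map (algebraMap ℝ ℂ)) := by
    ext (i | i) (j | j) <;> simp [holdMatrix]
  rw [e] at h
  exact h

/-- Kalman–Ho–Narendra: sampling with a nonpathological period preserves controllability. -/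
theorem IsControllable.sampled {A : Matrix (Fin n) (Fin n) ℝ} {B : Matrix (Fin n) (Fin m) ℝ}
    (hAB : IsControllable A B) {T : ℝ} (hT : 0 < T) (hA : IsAdmissiblePeriod A T)
    {v : Fin n → ℝ}
    (h : ∀ k, v ᵥ* ((NormedSpace.exp (T • holdMatrix A B)).toBlocks₁₁ ^ k *
      (NormedSpace.exp (T • holdMatrix A B)).toBlocks₁₂) = 0) : v = 0 := by
  set E := NormedSpace.exp (T • holdMatrix A B) with hE
  set Ac := A.map (algebraMap ℝ ℂ) with hAc
  set Bc := B.map (algebraMap ℝ ℂ) with hBc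
  set F : Matrix (Fin n) (Fin n) ℂ := E.toBlocks₁₁.map (algebraMap ℝ ℂ) with hF
  set H : Matrix (Fin n) (Fin m) ℂ := E.toBlocks₁₂.map (algebraMap ℝ ℂ) with hH
  -- The uncontrollable left vectors of the sampled pair, over ℂ. If this Fᵀ-invariant space were
  -- nonzero it would contain a left eigenvector of `F` that annihilates `H`.
  let V : Submodule ℂ (Fin n → ℂ) := ⨅ k : ℕ, LinearMap.ker (F ^ k * H).vecMulLinear
  have memV : ∀ w, w ∈ V ↔ ∀ k : ℕ, w ᵥ* (F ^ k * H) = 0 := fun w => by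
    simp [V, Submodule.mem_iInf]
  have hinv : ∀ w ∈ V, Fᵀ.toLin' w ∈ V := fun w hw => by
    rw [memV] at hw ⊢
    intro k
    rw [Matrix.toLin'_apply, Matrix.mulVec_transpose, Matrix.vecMul_vecMul, ← Matrix.mul_assoc,
      ← pow_succ', hw]
  have hVbot : V = ⊥ := by
    by_contra hne
    have : Nontrivial V := Submodule.nontrivial_iff_ne_bot.mpr hne
    obtain ⟨z, hz⟩ := Module.End.exists_eigenvalue (Fᵀ.toLin'.restrict hinv)
    obtain ⟨w, hw⟩ := hz.exists_hasEigenvector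
    have hw0 : (w : Fin n → ℂ) ≠ 0 := fun h0 => hw.2 (Subtype.ext h0)
    have hwF : (w : Fin n → ℂ) ᵥ* F = z • (w : Fin n → ℂ) := by
      have := congrArg Subtype.val hw.apply_eq_smul
      rw [LinearMap.coe_restrict_apply, Matrix.toLin'_apply, Matrix.mulVec_transpose] at this
      exact this
    have hwH : (w : Fin n → ℂ) ᵥ* H = 0 := by
      simpa using (memV _).mp w.2 0
    have hEc : E.map (algebraMap ℝ ℂ) =
        fromBlocks F H (E.toBlocks₂₁.map (algebraMap ℝ ℂ)) (E.toBlocks₂₂.map (algebraMap ℝ ℂ)) := by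
      rw [hF, hH, ← Matrix.fromBlocks_map, Matrix.fromBlocks_toBlocks]
    -- Because wH = 0, the padded vector (w, 0) is a left eigenvector of the whole exponential,
    -- hence of the hold matrix; reading off blocks gives wA = λw and wB = 0.
    have hexp : (NormedSpace.exp ((T : ℂ) • (holdMatrix Ac Bc)ᵀ)) *ᵥ (Sum.elim (w : Fin n → ℂ) 0)
        = z • Sum.elim (w : Fin n → ℂ) 0 := by
      rw [← Matrix.transpose_smul, Matrix.exp_transpose, ← exp_holdMatrix_map,
        Matrix.mulVec_transpose, ← hE, hEc, Matrix.vecMul_fromBlocks]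
      ext (i | i)
      · simp [hwF]
      · simp [hwH]
    obtain ⟨lam, hlam, -⟩ := exists_mulVec_eq_smul_of_exp (M := (holdMatrix Ac Bc)ᵀ)
      (by exact_mod_cast hT.ne')
      (fun a b ha hb hab => hA.exp_injOn_holdMatrix hT (hasEigenvalue_holdMatrix_transpose ha)
        (hasEigenvalue_holdMatrix_transpose hb) hab)
      (fun h0 => hw0 (funext fun i => congrFun h0 (Sum.inl i))) hexp
    rw [Matrix.mulVec_transpose, holdMatrix, Matrix.vecMul_fromBlocks] at hlam
    have hwA : (w : Fin n → ℂ) ᵥ* Ac = lam • (w : Fin n → ℂ) := by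
      ext i
      simpa using congrFun hlam (Sum.inl i)
    have hwB : (w : Fin n → ℂ) ᵥ* Bc = 0 := by
      ext i
      simpa using congrFun hlam (Sum.inr i)
    have hwAB : ∀ k : ℕ, (w : Fin n → ℂ) ᵥ* (Ac ^ k * Bc) = 0 := by
      intro k
      rw [← Matrix.vecMul_vecMul]
      have : ∀ k : ℕ, (w : Fin n → ℂ) ᵥ* (Ac ^ k) = lam ^ k • (w : Fin n → ℂ) := by
        intro k
        induction k with
        | zero => simp
        | succ k ih =>
          rw [pow_succ, ← Matrix.vecMul_vecMul, ih, Matrix.smul_vecMul, hwA, smul_smul, ← pow_succ]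
      rw [this, Matrix.smul_vecMul, hwB, smul_zero]
    have hmap : ∀ k : ℕ, Ac ^ k * Bc = (A ^ k * B).map (algebraMap ℝ ℂ) := fun k => by
      rw [Matrix.map_mul, hAc, hBc]
      congr 1
      exact (map_pow (algebraMap ℝ ℂ).mapMatrix A k).symm
    apply hw0
    have hre : (fun i => ((w : Fin n → ℂ) i).re) = 0 := hAB.eq_zero_of_vecMul fun k => by
      ext j
      have := congrArg Complex.re (congrFun (hwAB k) j)
      rw [hmap] at this
      simpa [Matrix.vecMul, dotProduct] using this
    have him : (fun i => ((w : Fin n → ℂ) i).im) = 0 := hAB.eq_zero_of_vecMul fun k => by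
      ext j
      have := congrArg Complex.im (congrFun (hwAB k) j)
      rw [hmap] at this
      simpa [Matrix.vecMul, dotProduct] using this
    exact funext fun i => Complex.ext (congrFun hre i) (congrFun him i)
  have hv : (fun i => (v i : ℂ)) ∈ V := by
    rw [memV]
    intro k
    have hmap : F ^ k * H = (E.toBlocks₁₁ ^ k * E.toBlocks₁₂).map (algebraMap ℝ ℂ) := by
      rw [Matrix.map_mul, hF, hH]
      congr 1
      exact (map_pow (algebraMap ℝ ℂ).mapMatrix _ k).symm
    ext j
    rw [hmap]
    have := congrArg (algebraMap ℝ ℂ) (congrFun (h k) j)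
    simpa [Matrix.vecMul, dotProduct] using this
  rw [hVbot, Submodule.mem_bot] at hv
  exact funext fun i => by simpa using congrFun hv i

/-- Willems' fundamental lemma in discrete time, in dual form: the state–input data of a
controllable system under an input persistently exciting of order `n + 1` has full row rank. -/
theorem eq_zero_of_dotProduct_data_eq_zero {F : Matrix (Fin n) (Fin n) ℝ}
    {H : Matrix (Fin n) (Fin m) ℝ}
    (hFH : ∀ v : Fin n → ℝ, (∀ k, v ᵥ* (F ^ k * H) = 0) → v = 0) {N : ℕ} (hN : n + 1 ≤ N)
    {μ : ℕ → Fin m → ℝ} (hμ : (blockHankel N (n + 1) μ).rank = m * (n + 1))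
    {ξ : ℕ → Fin n → ℝ} (hξ : ∀ j < N, ξ (j + 1) = F *ᵥ ξ j + H *ᵥ μ j)
    {v : Fin n → ℝ} {w : Fin m → ℝ} (h : ∀ j < N, v ⬝ᵥ ξ j + w ⬝ᵥ μ j = 0) : v = 0 ∧ w = 0 := by
  set c : ℕ → Fin m → ℝ := fun r => v ᵥ* (F ^ r * H) with hc
  have hstep : ∀ j k, j + k ≤ N →
      v ⬝ᵥ ξ (j + k) = v ⬝ᵥ (F ^ k *ᵥ ξ j) + ∑ i ∈ Finset.range k, c (k - 1 - i) ⬝ᵥ μ (j + i) := by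
    intro j k hjk
    have hs : ∀ k, j + k ≤ N → ξ (j + k) = F ^ k *ᵥ ξ j +
        ∑ i ∈ Finset.range k, (F ^ (k - 1 - i) * H) *ᵥ μ (j + i) := by
      intro k
      induction k with
      | zero => intro _; simp
      | succ k ih =>
        intro hk
        rw [← add_assoc, hξ (j + k) (by omega), ih (by omega), Matrix.mulVec_add,
          Matrix.mulVec_mulVec, ← pow_succ', Finset.sum_range_succ, add_assoc]
        congr 1
        rw [Matrix.mulVec_sum]
        congr 1
        · refine Finset.sum_congr rfl fun i hi => ?_
          have hi' := Finset.mem_range.mp hi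
          rw [Matrix.mulVec_mulVec, ← Matrix.mul_assoc, ← pow_succ']
          congr 3
          omega
        · simp
    rw [hs k hjk, dotProduct_add]
    congr 1
    rw [dotProduct_sum]
    exact Finset.sum_congr rfl fun i _ => by rw [Matrix.dotProduct_mulVec]
  set α : ℕ → ℝ := F.charpoly.coeff with hα
  have hdeg : F.charpoly.natDegree = n := by simp
  have hαn : α n = 1 := by
    have := F.charpoly_monic.coeff_natDegree
    rwa [hdeg] at this
  have hCH : ∑ k ∈ Finset.range (n + 1), α k • F ^ k = 0 := by
    rw [← Polynomial.aeval_eq_sum_range' (by omega) F]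
    exact F.aeval_self_charpoly
  -- Weighting the relations at times j, …, j + n by the coefficients of the characteristic
  -- polynomial eliminates the state by Cayley–Hamilton. What remains is a relation among n + 1
  -- consecutive inputs, and `g i` is the coefficient of μ (j + i); excitation of order n + 1 forces
  -- `g = 0`.
  set g : ℕ → Fin m → ℝ := fun i => α i • w +
    ∑ k ∈ Finset.range (n + 1), if i < k then α k • c (k - 1 - i) else 0 with hg
  have hg0 : ∀ i < n + 1, g i = 0 := by
    have hz : (fun ia : Fin (n + 1) × Fin m => g ia.1 ia.2) = 0 := by
      refine eq_zero_of_vecMul_eq_zero_of_rank (C := blockHankel N (n + 1) μ)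
        (by rw [hμ, Fintype.card_prod, Fintype.card_fin, Fintype.card_fin, mul_comm]) ?_
      ext j
      have hj : (j : ℕ) + n < N := by have := j.2; omega
      have hsum : ∑ i ∈ Finset.range (n + 1), g i ⬝ᵥ μ (j + i) = 0 := by
        have h1 : ∀ k ∈ Finset.range (n + 1), α k * (w ⬝ᵥ μ (j + k)) +
            α k * ∑ i ∈ Finset.range k, c (k - 1 - i) ⬝ᵥ μ (j + i) =
            -(v ⬝ᵥ ((α k • F ^ k) *ᵥ ξ j)) := by
          intro k hk
          have hk' := Finset.mem_range.mp hk
          have e1 := hstep j k (by omega)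
          have e2 := h (j + k) (by omega)
          rw [Matrix.smul_mulVec, dotProduct_smul, smul_eq_mul, ← mul_add, ← mul_neg]
          congr 1
          linarith
        have h2 : ∑ i ∈ Finset.range (n + 1), g i ⬝ᵥ μ (j + i) =
            ∑ k ∈ Finset.range (n + 1), (α k * (w ⬝ᵥ μ (j + k)) +
            α k * ∑ i ∈ Finset.range k, c (k - 1 - i) ⬝ᵥ μ (j + i)) := by
          rw [Finset.sum_add_distrib]
          simp only [hg, add_dotProduct, smul_dotProduct, smul_eq_mul, sum_dotProduct]
          rw [Finset.sum_add_distrib]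
          congr 1
          rw [Finset.sum_comm]
          refine Finset.sum_congr rfl fun k hk => ?_
          have hk' := Finset.mem_range.mp hk
          rw [Finset.mul_sum]
          have hsub : Finset.range k = (Finset.range (n + 1)).filter (· < k) := by
            ext i
            simp only [Finset.mem_range, Finset.mem_filter]
            omega
          rw [hsub, Finset.sum_filter]
          refine Finset.sum_congr rfl fun i _ => ?_
          split_ifs <;> simp
        rw [h2, Finset.sum_congr rfl h1, Finset.sum_neg_distrib, ← dotProduct_sum,
          ← Matrix.sum_mulVec, hCH, Matrix.zero_mulVec, dotProduct_zero, neg_zero]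
      rw [Finset.sum_range] at hsum
      rw [Matrix.vecMul, dotProduct, Fintype.sum_prod_type, Pi.zero_apply, ← hsum]
      refine Finset.sum_congr rfl fun i _ => ?_
      rw [dotProduct]
      refine Finset.sum_congr rfl fun a _ => ?_
      simp only [blockHankel, Matrix.of_apply, add_comm]
    intro i hi
    ext a
    exact congrFun hz (⟨i, hi⟩, a)
  have hw : w = 0 := by
    have := hg0 n (by omega)
    rw [hg] at this
    simp only [hαn, one_smul] at this
    rwa [Finset.sum_eq_zero fun k hk => if_neg (by have := Finset.mem_range.mp hk; omega),
      add_zero] at this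
  refine ⟨hFH v (vecMul_pow_mul_eq_zero ?_), hw⟩
  -- The system is triangular: once `w = 0`, `g (n - 1 - r)` is `c r` (from k = n, with leading
  -- coefficient 1) plus multiples of earlier `c`.
  intro r
  induction r using Nat.strong_induction_on with
  | _ r ih =>
    intro hr
    have := hg0 (n - 1 - r) (by omega)
    simp only [hg, hw, smul_zero, zero_add] at this
    rw [Finset.sum_range_succ, if_pos (by omega), hαn, one_smul, Finset.sum_eq_zero, zero_add]
      at this
    · have e : n - 1 - (n - 1 - r) = r := by omega
      rwa [e] at this
    · intro k hk
      have hk' := Finset.mem_range.mp hk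
      split_ifs with hlt
      · simp only [hc]
        rw [ih _ (by omega) (by omega), smul_zero]
      · rfl

end Sampling

/-! ### From the measured data to the Riccati equation. -/

section Data

open Matrix Set MeasureTheory

variable {n m N : ℕ} {A : Matrix (Fin n) (Fin n) ℝ} {B : Matrix (Fin n) (Fin m) ℝ}
  {τ T : ℝ} {u : ℝ → Fin m → ℝ} {x : ℝ → Fin n → ℝ}

theorem continuous_mulVec {ι κ : Type*} [Fintype κ] (M : Matrix ι κ ℝ) :
    Continuous fun v => M *ᵥ v :=
  Continuous.matrix_mulVec continuous_const continuous_id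

theorem IsTrajectoryOn.intervalIntegrable (hx : IsTrajectoryOn A B τ u x) {a b : ℝ}
    (ha : a ∈ Icc 0 τ) (hb : b ∈ Icc 0 τ) :
    IntervalIntegrable (fun s => A *ᵥ x s + B *ᵥ u s) volume a b := by
  have hsub : uIcc a b ⊆ Icc 0 τ := uIcc_subset_Icc ha hb
  refine IntervalIntegrable.add ?_ ?_
  · exact (((continuous_mulVec A).comp_continuousOn hx.continuousOn_state).mono
      hsub).intervalIntegrable
  · rw [intervalIntegrable_iff]
    exact (LinearMap.toContinuousLinearMap B.mulVecLin).integrable_comp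
      (hx.integrableOn_input.mono_set (uIoc_subset_uIcc.trans hsub))

theorem IsTrajectoryOn.state_eq_add_integral (hx : IsTrajectoryOn A B τ u x) {a b : ℝ}
    (ha : a ∈ Icc 0 τ) (hb : b ∈ Icc 0 τ) :
    x b = x a + ∫ s in a..b, (A *ᵥ x s + B *ᵥ u s) := by
  have h0 : (0 : ℝ) ∈ Icc 0 τ := ⟨le_rfl, ha.1.trans ha.2⟩
  rw [hx.state_eq a ha, hx.state_eq b hb, add_assoc,
    intervalIntegral.integral_add_adjacent_intervals (hx.intervalIntegrable h0 ha)
      (hx.intervalIntegrable ha hb)]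

theorem IsTrajectoryOn.hasDerivWithinAt_of_const_input (hx : IsTrajectoryOn A B τ u x) {a b : ℝ}
    (ha : 0 ≤ a) (hb : b ≤ τ) {μ : Fin m → ℝ} (hu : ∀ s ∈ Ico a b, u s = μ) {t : ℝ}
    (ht : t ∈ Icc a b) : HasDerivWithinAt x (A *ᵥ x t + B *ᵥ μ) (Icc a b) t := by
  have hsub : Icc a b ⊆ Icc 0 τ := Icc_subset_Icc ha hb
  refine hasDerivWithinAt_of_eq_integral (f := fun s => A *ᵥ x s + B *ᵥ μ) ?_ (fun r hr => ?_) ht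
  · exact ((continuous_mulVec A).comp_continuousOn (hx.continuousOn_state.mono hsub)).add
      continuousOn_const
  · rw [hx.state_eq_add_integral (hsub (left_mem_Icc.mpr (hr.1.trans hr.2))) (hsub hr)]
    congr 1
    refine intervalIntegral.integral_congr_ae ?_
    -- The input may jump at `b`, where its value is not prescribed; a single point does not affect
    -- the integral.
    filter_upwards [compl_mem_ae_iff.mpr (measure_singleton b)] with s hs hsr
    rw [uIoc_of_le hr.1] at hsr
    rw [hu s ⟨hsr.1.le, lt_of_le_of_ne (hsr.2.trans hr.2) hs⟩]

theorem sumElim_eq_exp_holdMatrix {a b : ℝ} {μ : Fin m → ℝ}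
    (hx : ∀ t ∈ Icc a b, HasDerivWithinAt x (A *ᵥ x t + B *ᵥ μ) (Icc a b) t) {t : ℝ}
    (ht : t ∈ Icc a b) : Sum.elim (x t) μ =
      NormedSpace.exp ((t - a) • holdMatrix A B) *ᵥ Sum.elim (x a) μ := by
  refine eq_exp_smul_mulVec (z := fun s => Sum.elim (x s) μ) (fun s hs => ?_) ht
  have h := hx s hs
  rw [hasDerivWithinAt_pi] at h ⊢
  rintro (i | i)
  · simpa [holdMatrix, fromBlocks_mulVec] using h i
  · simpa [holdMatrix, fromBlocks_mulVec] using hasDerivWithinAt_const s (Icc a b) (μ i)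

/-- The matrix of state and input data has full row rank (in dual form). -/
theorem eq_zero_of_vecMul_data_eq_zero (hAB : IsControllable A B) (hu : IsPCPE A T N (n + 1) u)
    (hx : IsTrajectoryOn A B (N * T) u x) {t : ℝ} (ht : t ∈ Icc 0 T) {v : Fin n → ℝ}
    {w : Fin m → ℝ} (h : v ᵥ* hankelRow T N x t + w ᵥ* inputData T N u = 0) : v = 0 ∧ w = 0 := by
  obtain ⟨μ, hμ, hrank⟩ := hu.exists_values
  have hT := hu.period_pos
  have hderiv : ∀ j < N, ∀ r ∈ Icc (j * T) ((j + 1) * T),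
      HasDerivWithinAt x (A *ᵥ x r + B *ᵥ μ j) (Icc (j * T) ((j + 1) * T)) r := by
    intro j hj r hr
    refine hx.hasDerivWithinAt_of_const_input (by positivity) ?_ (fun s hs => ?_) hr
    · have : ((j + 1 : ℕ) : ℝ) ≤ N := by exact_mod_cast hj
      push_cast at this
      gcongr
    · have := hμ j hj (s - j * T) ⟨by linarith [hs.1], by linarith [hs.2]⟩
      rwa [sub_add_cancel] at this
  have hflow : ∀ j < N, ∀ r ∈ Icc 0 T, Sum.elim (x (r + j * T)) (μ j) =
      NormedSpace.exp (r • holdMatrix A B) *ᵥ Sum.elim (x (j * T)) (μ j) := by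
    intro j hj r hr
    have := sumElim_eq_exp_holdMatrix (hderiv j hj) (t := r + j * T)
      ⟨by linarith [hr.1], by linarith [hr.2]⟩
    rwa [add_sub_cancel_right] at this
  set E := NormedSpace.exp (t • holdMatrix A B) with hE
  -- Pulling the annihilator back along the flow from offset t to offset 0 turns it into an
  -- annihilator of the samples x(jT), μ j. The exponential is invertible, so y = 0 suffices.
  set y := Sum.elim v w ᵥ* E with hy
  have hkill : ∀ j < N, (y ∘ Sum.inl) ⬝ᵥ x (j * T) + (y ∘ Sum.inr) ⬝ᵥ μ j = 0 := by
    intro j hj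
    have h1 := congrFun h ⟨j, hj⟩
    have hin : u (0 + (j : ℝ) * T) = μ j := hμ j hj 0 ⟨le_rfl, hT⟩
    have h2 : v ⬝ᵥ x (t + j * T) + w ⬝ᵥ μ j = 0 := by
      rw [← hin]
      exact h1
    have h3 : Sum.elim v w ⬝ᵥ Sum.elim (x (t + j * T)) (μ j) = 0 := by
      rw [sumElim_dotProduct_sumElim, h2]
    rw [hflow j hj t ht, Matrix.dotProduct_mulVec, ← hE, ← hy] at h3
    rw [← sumElim_dotProduct_sumElim, Sum.elim_comp_inl_inr, h3]
  set Φ := NormedSpace.exp (T • holdMatrix A B) with hΦ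
  have hstep : ∀ j < N, x ((j + 1 : ℕ) * T) = Φ.toBlocks₁₁ *ᵥ x (j * T) + Φ.toBlocks₁₂ *ᵥ μ j := by
    intro j hj
    have h1 := hflow j hj T ⟨hT.le, le_rfl⟩
    rw [← hΦ, ← Matrix.fromBlocks_toBlocks Φ, Matrix.fromBlocks_mulVec] at h1
    ext i
    have h2 := congrFun h1 (Sum.inl i)
    have e : ((j + 1 : ℕ) : ℝ) * T = T + j * T := by push_cast; ring
    rw [e]
    simpa using h2
  obtain ⟨hy1, hy2⟩ := eq_zero_of_dotProduct_data_eq_zero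
    (fun v hv => hAB.sampled hT hu.period_admissible hv) hu.order_le hrank
    (ξ := fun j => x (j * T)) hstep hkill
  have hy0 : y = 0 := by
    rw [← Sum.elim_comp_inl_inr y, hy1, hy2]
    ext (i | i) <;> rfl
  have hvw : Sum.elim v w = 0 := Matrix.vecMul_injective_of_isUnit (Matrix.isUnit_exp _)
    (hy0.trans (Matrix.zero_vecMul E).symm)
  exact ⟨funext fun i => congrFun hvw (Sum.inl i), funext fun i => congrFun hvw (Sum.inr i)⟩

theorem derivData_eq (hu : IsPCPE A T N (n + 1) u) (hx : IsTrajectoryOn A B (N * T) u x) {t : ℝ}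
    (ht : t ∈ Icc 0 T) :
    derivData T N x t = A * hankelRow T N x t + B * inputData T N u := by
  obtain ⟨μ, hμ, -⟩ := hu.exists_values
  have hT := hu.period_pos
  ext i ⟨j, hj⟩
  have hd : HasDerivWithinAt x (A *ᵥ x (t + j * T) + B *ᵥ μ j) (Icc (j * T) ((j + 1) * T))
      (t + j * T) := by
    refine hx.hasDerivWithinAt_of_const_input (by positivity) ?_ (fun s hs => ?_)
      ⟨by linarith [ht.1], by linarith [ht.2]⟩
    · have : ((j + 1 : ℕ) : ℝ) ≤ N := by exact_mod_cast hj
      push_cast at this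
      gcongr
    · have := hμ j hj (s - j * T) ⟨by linarith [hs.1], by linarith [hs.2]⟩
      rwa [sub_add_cancel] at this
  have hin : u (0 + (j : ℝ) * T) = μ j := hμ j hj 0 ⟨le_rfl, hT⟩
  have huniq : UniqueDiffWithinAt ℝ (Icc ((j : ℝ) * T) ((j + 1) * T)) (t + j * T) :=
    uniqueDiffOn_Icc (by linarith) _ ⟨by linarith [ht.1], by linarith [ht.2]⟩
  rw [derivData, Matrix.of_apply, hd.derivWithin huniq, ← hin]
  rfl

/-- The data-based equation for `Γ` yields the optimality conditions for the gain and, with them,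
the algebraic Riccati equation. -/
theorem riccati_of_data {Q P : Matrix (Fin n) (Fin n) ℝ} {R : Matrix (Fin m) (Fin m) ℝ}
    (hAB : IsControllable A B) (hu : IsPCPE A T N (n + 1) u)
    (hx : IsTrajectoryOn A B (N * T) u x) {t : ℝ} (ht : t ∈ Icc 0 T)
    {Γ : Matrix (Fin N) (Fin n) ℝ} (h1 : hankelRow T N x t * Γ = 1)
    (h2 : dataLMI Q R T N u x t P * Γ = 0) :
    R * (inputData T N u * Γ) + Bᵀ * P = 0 ∧
      Q + P * (A + B * (inputData T N u * Γ)) + Aᵀ * P = 0 := by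
  set X := hankelRow T N x t with hX
  set U := inputData T N u with hU
  set G := U * Γ with hG
  have hL : Xᵀ * (Q + P * (A + B * G) + Aᵀ * P) + Uᵀ * (R * G + Bᵀ * P) = 0 := by
    rw [← h2, dataLMI, derivData_eq hu hx ht, ← hX, ← hU]
    simp only [Matrix.transpose_add, Matrix.transpose_mul, Matrix.mul_add, Matrix.add_mul,
      Matrix.mul_assoc, h1, Matrix.mul_one, ← hG]
    abel
  -- Each column of `hL` is a vanishing combination of the rows of the data, so full row rank kills
  -- both coefficient vectors.
  have hcol : ∀ k, (Q + P * (A + B * G) + Aᵀ * P).col k = 0 ∧ (R * G + Bᵀ * P).col k = 0 := by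
    intro k
    refine eq_zero_of_vecMul_data_eq_zero hAB hu hx ht ?_
    ext j
    have := congrFun (congrFun hL j) k
    rw [← hX, ← hU, ← Matrix.mulVec_transpose, ← Matrix.mulVec_transpose]
    exact this
  exact ⟨Matrix.ext fun i k => congrFun (hcol k).2 i, Matrix.ext fun i k => congrFun (hcol k).1 i⟩

end Data

/-! ### Quadratic estimates and completion of squares. -/

section QuadraticForms

open Matrix

variable {n m : ℕ}

theorem mulVec_dotProduct_eq_of_isSymm {ι : Type*} [Fintype ι] {S : Matrix ι ι ℝ} (hS : S.IsSymm)
    (v w : ι → ℝ) : S *ᵥ v ⬝ᵥ w = v ⬝ᵥ S *ᵥ w := by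
  rw [Matrix.dotProduct_mulVec, ← Matrix.mulVec_transpose, hS.eq]

theorem dotProduct_self_nonneg_real {ι : Type*} [Fintype ι] (v : ι → ℝ) : 0 ≤ v ⬝ᵥ v :=
  Finset.sum_nonneg fun i _ => mul_self_nonneg (v i)

theorem dotProduct_add_self_le {ι : Type*} [Fintype ι] (v w : ι → ℝ) :
    (v + w) ⬝ᵥ (v + w) ≤ 2 * (v ⬝ᵥ v) + 2 * (w ⬝ᵥ w) := by
  have := dotProduct_self_nonneg_real (v - w)
  simp only [sub_dotProduct, dotProduct_sub, add_dotProduct, dotProduct_add,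
    dotProduct_comm w v] at this ⊢
  linarith

theorem exists_mulVec_dotProduct_self_le {ι κ : Type*} [Fintype ι] [Fintype κ]
    (M : Matrix ι κ ℝ) : ∃ c : ℝ, 0 ≤ c ∧ ∀ v, M *ᵥ v ⬝ᵥ M *ᵥ v ≤ c * (v ⬝ᵥ v) := by
  refine ⟨∑ i, ∑ j, M i j ^ 2, by positivity, fun v => ?_⟩
  rw [Finset.sum_mul]
  refine Finset.sum_le_sum fun i _ => ?_
  have := Finset.sum_mul_sq_le_sq_mul_sq Finset.univ (M i) v
  simpa [Matrix.mulVec, dotProduct, pow_two] using this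

theorem isSymm_of_posSemidef {S : Matrix (Fin n) (Fin n) ℝ} (hS : S.PosSemidef) : S.IsSymm := by
  have := hS.isHermitian
  rwa [Matrix.IsHermitian, Matrix.conjTranspose_eq_transpose_of_trivial] at this

theorem matrixSqrt_mulVec_dotProduct_self {Q : Matrix (Fin n) (Fin n) ℝ} (hQ : Q.PosSemidef)
    (v : Fin n → ℝ) : matrixSqrt Q *ᵥ v ⬝ᵥ matrixSqrt Q *ᵥ v = v ⬝ᵥ Q *ᵥ v := by
  rw [mulVec_dotProduct_eq_of_isSymm (isSymm_of_posSemidef (matrixSqrt_posSemidef Q)),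
    Matrix.mulVec_mulVec,
    matrixSqrt_mul_self hQ]

theorem quadraticForm_nonneg {Q : Matrix (Fin n) (Fin n) ℝ} (hQ : Q.PosSemidef) (v : Fin n → ℝ) :
    0 ≤ v ⬝ᵥ Q *ᵥ v := by
  simpa using hQ.dotProduct_mulVec_nonneg v

theorem exists_dotProduct_self_le_of_posDef {R : Matrix (Fin n) (Fin n) ℝ} (hR : R.PosDef) :
    ∃ c : ℝ, 0 ≤ c ∧ ∀ v, v ⬝ᵥ v ≤ c * (v ⬝ᵥ R *ᵥ v) := by
  have hunit : IsUnit (matrixSqrt R) := by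
    have h := hR.isUnit
    rw [← matrixSqrt_mul_self hR.posSemidef] at h
    exact isUnit_of_mul_isUnit_left h
  obtain ⟨c, hc, h⟩ := exists_mulVec_dotProduct_self_le (matrixSqrt R)⁻¹
  refine ⟨c, hc, fun v => ?_⟩
  have := h (matrixSqrt R *ᵥ v)
  rwa [Matrix.mulVec_mulVec, Matrix.nonsing_inv_mul _ ((Matrix.isUnit_iff_isUnit_det _).mp hunit),
    Matrix.one_mulVec, matrixSqrt_mulVec_dotProduct_self hR.posSemidef] at this

/-- A storage function witnessing that the state is square integrable along trajectories of finite
cost. -/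
theorem IsDetectable.exists_storage {A Q : Matrix (Fin n) (Fin n) ℝ} {B : Matrix (Fin n) (Fin m) ℝ}
    {R : Matrix (Fin m) (Fin m) ℝ} (hQ : Q.PosSemidef) (hR : R.PosDef)
    (hAQ : IsDetectable A (matrixSqrt Q)) :
    ∃ S : Matrix (Fin n) (Fin n) ℝ, S.PosSemidef ∧ ∃ c : ℝ, 0 ≤ c ∧ ∀ x u,
      2 * (S *ᵥ x ⬝ᵥ (A *ᵥ x + B *ᵥ u)) ≤
        -(1 / 2) * (x ⬝ᵥ x) + c * (x ⬝ᵥ Q *ᵥ x + u ⬝ᵥ R *ᵥ u) := by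
  obtain ⟨F, hF⟩ := hAQ
  obtain ⟨S, hS, hlyap⟩ := hF.exists_lyapunov
  obtain ⟨c₁, hc₁, h₁⟩ := exists_mulVec_dotProduct_self_le (S * F)
  obtain ⟨c₂, hc₂, h₂⟩ := exists_mulVec_dotProduct_self_le (S * B)
  obtain ⟨c₃, hc₃, h₃⟩ := exists_dotProduct_self_le_of_posDef hR
  refine ⟨S, hS, 4 * c₁ + 4 * (c₂ * c₃), by positivity, fun x u => ?_⟩
  set y := matrixSqrt Q *ᵥ x with hy
  -- Output injection: the dynamics become Hurwitz, driven by `y` and `u`, both of which the running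
  -- cost controls.
  have hsplit : A *ᵥ x + B *ᵥ u = (A - F * matrixSqrt Q) *ᵥ x + (F *ᵥ y + B *ᵥ u) := by
    rw [Matrix.sub_mulVec, ← Matrix.mulVec_mulVec, ← hy]
    abel
  have hq := quadraticForm_nonneg hQ x
  have hr := quadraticForm_nonneg hR.posSemidef u
  have hw : S *ᵥ (F *ᵥ y + B *ᵥ u) = (S * F) *ᵥ y + (S * B) *ᵥ u := by
    rw [Matrix.mulVec_add, Matrix.mulVec_mulVec y, Matrix.mulVec_mulVec u]
  -- Young's inequality, from |x - 2w|² ≥ 0, spends half of the Lyapunov decay. Its factor 2 and the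
  -- 2 of `dotProduct_add_self_le` produce the 4 in the constant.
  have hcross : 2 * (S *ᵥ x ⬝ᵥ (F *ᵥ y + B *ᵥ u)) ≤ 1 / 2 * (x ⬝ᵥ x) +
      2 * (((S * F) *ᵥ y + (S * B) *ᵥ u) ⬝ᵥ ((S * F) *ᵥ y + (S * B) *ᵥ u)) := by
    rw [mulVec_dotProduct_eq_of_isSymm (isSymm_of_posSemidef hS), hw]
    set w := (S * F) *ᵥ y + (S * B) *ᵥ u
    have := dotProduct_self_nonneg_real (x - (2 : ℝ) • w)
    simp only [sub_dotProduct, dotProduct_sub, smul_dotProduct, dotProduct_smul, smul_eq_mul,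
      dotProduct_comm w x] at this
    linarith
  have hsum := dotProduct_add_self_le ((S * F) *ᵥ y) ((S * B) *ᵥ u)
  have hl := hlyap x
  have hy2 : y ⬝ᵥ y = x ⬝ᵥ Q *ᵥ x := matrixSqrt_mulVec_dotProduct_self hQ x
  have h1 := h₁ y
  have h2 : (S * B) *ᵥ u ⬝ᵥ (S * B) *ᵥ u ≤ c₂ * (c₃ * (u ⬝ᵥ R *ᵥ u)) :=
    (h₂ u).trans (mul_le_mul_of_nonneg_left (h₃ u) hc₂)
  rw [hy2] at h1
  rw [hsplit, dotProduct_add]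
  have e1 : 0 ≤ c₁ * (u ⬝ᵥ R *ᵥ u) := mul_nonneg hc₁ hr
  have e2 : 0 ≤ c₂ * c₃ * (x ⬝ᵥ Q *ᵥ x) := mul_nonneg (mul_nonneg hc₂ hc₃) hq
  linarith

/-- `hK` matches the terms mixing u and x, and with `hric` it gives (Kx)ᵀR(Kx) = xᵀPBKx = xᵀQx +
2(Px)ᵀAx. -/
theorem completion_of_squares {A Q P : Matrix (Fin n) (Fin n) ℝ} {B : Matrix (Fin n) (Fin m) ℝ}
    {R : Matrix (Fin m) (Fin m) ℝ} {K : Matrix (Fin m) (Fin n) ℝ} (hP : P.IsSymm) (hR : R.IsSymm)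
    (hK : R * K = Bᵀ * P) (hric : Q + P * A + Aᵀ * P = P * B * K) (x : Fin n → ℝ)
    (u : Fin m → ℝ) :
    x ⬝ᵥ Q *ᵥ x + u ⬝ᵥ R *ᵥ u + 2 * (P *ᵥ x ⬝ᵥ (A *ᵥ x + B *ᵥ u)) =
      (u + K *ᵥ x) ⬝ᵥ R *ᵥ (u + K *ᵥ x) := by
  have hcross : ∀ w : Fin m → ℝ, w ⬝ᵥ R *ᵥ (K *ᵥ x) = P *ᵥ x ⬝ᵥ B *ᵥ w := fun w => by
    rw [Matrix.mulVec_mulVec, hK, ← Matrix.mulVec_mulVec, Matrix.dotProduct_mulVec,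
      Matrix.vecMul_transpose, dotProduct_comm]
  have hcross' : K *ᵥ x ⬝ᵥ R *ᵥ u = P *ᵥ x ⬝ᵥ B *ᵥ u := by
    rw [← mulVec_dotProduct_eq_of_isSymm hR, dotProduct_comm, hcross]
  have hquad : P *ᵥ x ⬝ᵥ B *ᵥ (K *ᵥ x) = x ⬝ᵥ Q *ᵥ x + 2 * (P *ᵥ x ⬝ᵥ A *ᵥ x) := by
    have h1 : P *ᵥ x ⬝ᵥ B *ᵥ (K *ᵥ x) = x ⬝ᵥ (P * B * K) *ᵥ x := by
      rw [mulVec_dotProduct_eq_of_isSymm hP, Matrix.mulVec_mulVec, Matrix.mulVec_mulVec,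
        Matrix.mul_assoc]
    have h2 : x ⬝ᵥ (P * A) *ᵥ x = P *ᵥ x ⬝ᵥ A *ᵥ x := by
      rw [mulVec_dotProduct_eq_of_isSymm hP, Matrix.mulVec_mulVec]
    have h3 : x ⬝ᵥ (Aᵀ * P) *ᵥ x = P *ᵥ x ⬝ᵥ A *ᵥ x := by
      rw [← Matrix.mulVec_mulVec, Matrix.dotProduct_mulVec, Matrix.vecMul_transpose,
        dotProduct_comm]
    rw [h1, ← hric, Matrix.add_mulVec, Matrix.add_mulVec, dotProduct_add, dotProduct_add, h2, h3]
    ring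
  rw [Matrix.mulVec_add, add_dotProduct, dotProduct_add, dotProduct_add, dotProduct_add, hcross,
    hcross, hcross', hquad]
  ring

end QuadraticForms

/-! ### Integrating quadratic forms along Carathéodory trajectories. -/

section Trajectories

open Matrix Set MeasureTheory

variable {n m : ℕ} {A : Matrix (Fin n) (Fin n) ℝ} {B : Matrix (Fin n) (Fin m) ℝ}
  {τ : ℝ} {u : ℝ → Fin m → ℝ} {x : ℝ → Fin n → ℝ}

theorem intervalIntegrable_finsetSum {ι : Type*} {s : Finset ι} {f : ι → ℝ → ℝ} {a b : ℝ}
    (h : ∀ i ∈ s, IntervalIntegrable (f i) volume a b) :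
    IntervalIntegrable (fun t => ∑ i ∈ s, f i t) volume a b := by
  have := IntervalIntegrable.sum s h
  rwa [Finset.sum_fn] at this

theorem mul_sub_mul_eq_integral {F G f g : ℝ → ℝ} {a b : ℝ} (hab : a ≤ b)
    (hf : IntervalIntegrable f volume a b) (hg : IntervalIntegrable g volume a b)
    (hF : ∀ t ∈ Icc a b, F t = F a + ∫ s in a..t, f s)
    (hG : ∀ t ∈ Icc a b, G t = G a + ∫ s in a..t, g s) :
    F b * G b - F a * G a = ∫ s in a..b, (f s * G s + F s * g s) := by
  have hconst : ∀ c : ℝ, AbsolutelyContinuousOnInterval (fun _ => c) a b := fun c =>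
    (LipschitzWith.const c).lipschitzOnWith.absolutelyContinuousOnInterval
  have key := (((hconst (F a)).add (hf.absolutelyContinuousOnInterval_intervalIntegral
      left_mem_uIcc)).integral_deriv_mul_eq_sub ((hconst (G a)).add
      (hg.absolutelyContinuousOnInterval_intervalIntegral left_mem_uIcc)))
  have hb : b ∈ Icc a b := right_mem_Icc.mpr hab
  simp only [Pi.add_apply, intervalIntegral.integral_same, add_zero, ← hF b hb, ← hG b hb] at key
  rw [← key]
  refine intervalIntegral.integral_congr_ae ?_
  filter_upwards [hf.ae_hasDerivAt_integral, hg.ae_hasDerivAt_integral] with s hs1 hs2 hs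
  have hs' : s ∈ uIcc a b := uIoc_subset_uIcc hs
  have hsI : s ∈ Icc a b := by rwa [uIcc_of_le hab] at hs'
  have e1 : deriv ((fun _ => F a) + fun r => ∫ v in a..r, f v) s = f s :=
    ((hs1 hs' a left_mem_uIcc).const_add (F a)).deriv
  have e2 : deriv ((fun _ => G a) + fun r => ∫ v in a..r, g v) s = g s :=
    ((hs2 hs' a left_mem_uIcc).const_add (G a)).deriv
  rw [e1, e2, ← hF s hsI, ← hG s hsI]

theorem IsTrajectoryOn.intervalIntegrable_quadraticForm (hx : IsTrajectoryOn A B τ u x)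
    (hτ : 0 ≤ τ) (S : Matrix (Fin n) (Fin n) ℝ) :
    IntervalIntegrable (fun s => 2 * (S *ᵥ x s ⬝ᵥ (A *ᵥ x s + B *ᵥ u s))) volume 0 τ := by
  have h0 : (0 : ℝ) ∈ Icc 0 τ := ⟨le_rfl, hτ⟩
  have hint := hx.intervalIntegrable h0 (right_mem_Icc.mpr hτ)
  have hSx : ContinuousOn (fun s => S *ᵥ x s) (uIcc 0 τ) := by
    rw [uIcc_of_le hτ]
    exact (continuous_mulVec S).comp_continuousOn hx.continuousOn_state
  refine IntervalIntegrable.const_mul ?_ 2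
  simp only [dotProduct]
  refine intervalIntegrable_finsetSum fun i _ => ?_
  refine IntervalIntegrable.continuousOn_mul ?_ ((continuous_apply i).comp_continuousOn hSx)
  rw [intervalIntegrable_iff] at hint ⊢
  exact hint.eval i

/-- The input is merely integrable, so the state need not be differentiable everywhere; the product
rule for absolutely continuous functions is applied to each product of coordinates. -/
theorem IsTrajectoryOn.quadraticForm_sub (hx : IsTrajectoryOn A B τ u x) (hτ : 0 ≤ τ)
    {S : Matrix (Fin n) (Fin n) ℝ} (hS : S.IsSymm) :
    x τ ⬝ᵥ S *ᵥ x τ - x 0 ⬝ᵥ S *ᵥ x 0 =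
      ∫ s in (0 : ℝ)..τ, 2 * (S *ᵥ x s ⬝ᵥ (A *ᵥ x s + B *ᵥ u s)) := by
  have h0 : (0 : ℝ) ∈ Icc 0 τ := ⟨le_rfl, hτ⟩
  have hττ : τ ∈ Icc 0 τ := right_mem_Icc.mpr hτ
  set f : ℝ → Fin n → ℝ := fun s => A *ᵥ x s + B *ᵥ u s with hf
  have hint := hx.intervalIntegrable h0 hττ
  have hfi : ∀ t ∈ Icc 0 τ, ∀ i, IntervalIntegrable (fun s => f s i) volume 0 t := by
    intro t ht i
    have := hx.intervalIntegrable h0 ht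
    rw [intervalIntegrable_iff] at this ⊢
    exact this.eval i
  have hcoord : ∀ i, ∀ t ∈ Icc 0 τ, x t i = x 0 i + ∫ s in (0 : ℝ)..t, f s i := by
    intro i t ht
    have h := congrFun (hx.state_eq t ht) i
    rw [h, Pi.add_apply]
    congr 1
    rw [intervalIntegral.integral_of_le ht.1, intervalIntegral.integral_of_le ht.1]
    refine eval_integral (E := fun _ => ℝ) (f := f) (fun j => ?_) i
    have := hfi t ht j
    rwa [intervalIntegrable_iff_integrableOn_Ioc_of_le ht.1] at this
  have hxc : ∀ i, ContinuousOn (fun s => x s i) (uIcc 0 τ) := fun i => by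
    rw [uIcc_of_le hτ]
    exact (continuous_apply i).comp_continuousOn hx.continuousOn_state
  have hprod : ∀ i j, x τ i * x τ j - x 0 i * x 0 j =
      ∫ s in (0 : ℝ)..τ, (f s i * x s j + x s i * f s j) := fun i j =>
    mul_sub_mul_eq_integral hτ (hfi τ hττ i) (hfi τ hττ j) (hcoord i) (hcoord j)
  have hprodint : ∀ i j, IntervalIntegrable (fun s => S i j * (f s i * x s j + x s i * f s j))
      volume 0 τ := fun i j =>
    (((hfi τ hττ i).mul_continuousOn (hxc j)).add
      ((hfi τ hττ j).continuousOn_mul (hxc i))).const_mul _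
  have hexp : ∀ v : Fin n → ℝ, v ⬝ᵥ S *ᵥ v = ∑ i, ∑ j, S i j * (v i * v j) := fun v => by
    simp only [dotProduct, Matrix.mulVec, Finset.mul_sum]
    exact Finset.sum_congr rfl fun i _ => Finset.sum_congr rfl fun j _ => by ring
  have hpt : ∀ s, 2 * (S *ᵥ x s ⬝ᵥ f s) =
      ∑ i, ∑ j, S i j * (f s i * x s j + x s i * f s j) := by
    intro s
    have e1 : S *ᵥ x s ⬝ᵥ f s = ∑ i, ∑ j, S i j * (f s i * x s j) := by
      simp only [dotProduct, Matrix.mulVec, Finset.sum_mul]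
      exact Finset.sum_congr rfl fun i _ => Finset.sum_congr rfl fun j _ => by ring
    have e2 : S *ᵥ x s ⬝ᵥ f s = ∑ i, ∑ j, S i j * (x s i * f s j) := by
      rw [mulVec_dotProduct_eq_of_isSymm hS]
      simp only [dotProduct, Matrix.mulVec, Finset.mul_sum]
      exact Finset.sum_congr rfl fun i _ => Finset.sum_congr rfl fun j _ => by ring
    simp only [mul_add, Finset.sum_add_distrib]
    rw [← e1, ← e2]
    ring
  rw [intervalIntegral.integral_congr fun s _ => hpt s]
  rw [intervalIntegral.integral_finsetSum fun i _ =>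
      intervalIntegrable_finsetSum fun j _ => hprodint i j,
    hexp, hexp, ← Finset.sum_sub_distrib]
  refine Finset.sum_congr rfl fun i _ => ?_
  rw [intervalIntegral.integral_finsetSum fun j _ => hprodint i j, ← Finset.sum_sub_distrib]
  refine Finset.sum_congr rfl fun j _ => ?_
  rw [intervalIntegral.integral_const_mul, ← hprod, mul_sub]

end Trajectories

/-! ### Lower bound for the cost, and the case of equality. -/

section Cost

open Matrix Set MeasureTheory Filter Topology

variable {n m : ℕ} {A Q P : Matrix (Fin n) (Fin n) ℝ} {B : Matrix (Fin n) (Fin m) ℝ}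
  {R : Matrix (Fin m) (Fin m) ℝ} {K : Matrix (Fin m) (Fin n) ℝ} {x₀ : Fin n → ℝ}
  {u : ℝ → Fin m → ℝ} {x : ℝ → Fin n → ℝ}

/-- The running cost `xᵀ Q x + uᵀ R u`. -/
def stageCost (Q : Matrix (Fin n) (Fin n) ℝ) (R : Matrix (Fin m) (Fin m) ℝ)
    (u : ℝ → Fin m → ℝ) (x : ℝ → Fin n → ℝ) (t : ℝ) : ℝ :=
  x t ⬝ᵥ Q *ᵥ x t + u t ⬝ᵥ R *ᵥ u t

theorem stageCost_nonneg (hQ : Q.PosSemidef) (hR : R.PosDef) (t : ℝ) : 0 ≤ stageCost Q R u x t :=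
  add_nonneg (quadraticForm_nonneg hQ _) (quadraticForm_nonneg hR.posSemidef _)

theorem IsAdmissible.aestronglyMeasurable_stageCost (h : IsAdmissible A B x₀ u x) :
    AEStronglyMeasurable (stageCost Q R u x) (volume.restrict (Ioi (0 : ℝ))) := by
  have hcont : Continuous fun q : (Fin n → ℝ) × (Fin m → ℝ) =>
      q.1 ⬝ᵥ Q *ᵥ q.1 + q.2 ⬝ᵥ R *ᵥ q.2 :=
    (continuous_fst.dotProduct ((continuous_mulVec Q).comp continuous_fst)).add
      (continuous_snd.dotProduct ((continuous_mulVec R).comp continuous_snd))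
  have hk : ∀ k : ℕ, AEStronglyMeasurable (stageCost Q R u x)
      (volume.restrict (Icc (0 : ℝ) k)) := fun k => by
    have htraj := h.2 k k.cast_nonneg
    exact hcont.comp_aestronglyMeasurable
      ((htraj.continuousOn_state.aestronglyMeasurable measurableSet_Icc).prodMk
        htraj.integrableOn_input.aestronglyMeasurable)
  refine (aestronglyMeasurable_iUnion_iff.mpr hk).mono_set fun t ht => ?_
  obtain ⟨k, hk⟩ := exists_nat_ge t
  exact mem_iUnion.mpr ⟨k, le_of_lt ht, hk⟩

theorem IsAdmissible.integrableOn_stageCost (hQ : Q.PosSemidef) (hR : R.PosDef)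
    (h : IsAdmissible A B x₀ u x) (hfin : lqrCost Q R u x < ∞) :
    IntegrableOn (stageCost Q R u x) (Ioi 0) :=
  (lintegral_ofReal_ne_top_iff_integrable h.aestronglyMeasurable_stageCost
    (Eventually.of_forall fun t => stageCost_nonneg hQ hR t)).mp hfin.ne

theorem lqrCost_eq_ofReal (hQ : Q.PosSemidef) (hR : R.PosDef)
    (hint : IntegrableOn (stageCost Q R u x) (Ioi 0)) :
    lqrCost Q R u x = ENNReal.ofReal (∫ t in Ioi 0, stageCost Q R u x t) :=
  (ofReal_integral_eq_lintegral_ofReal hint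
    (Eventually.of_forall fun t => stageCost_nonneg hQ hR t)).symm

theorem intervalIntegrable_of_integrableOn_Ioi {f : ℝ → ℝ} (hf : IntegrableOn f (Ioi 0)) {a b : ℝ}
    (ha : 0 ≤ a) (hb : 0 ≤ b) : IntervalIntegrable f volume a b := by
  rw [intervalIntegrable_iff]
  refine hf.mono_set fun t ht => ?_
  rw [uIoc, mem_Ioc] at ht
  exact lt_of_le_of_lt (le_min ha hb) ht.1

theorem intervalIntegral_le_integral_Ioi {f : ℝ → ℝ} (hf : IntegrableOn f (Ioi 0))
    (hnn : ∀ t, 0 ≤ f t) {τ : ℝ} (hτ : 0 ≤ τ) : ∫ t in (0 : ℝ)..τ, f t ≤ ∫ t in Ioi 0, f t := by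
  rw [intervalIntegral.integral_of_le hτ]
  exact setIntegral_mono_set hf (Eventually.of_forall hnn) (Ioc_subset_Ioi_self).eventuallyLE

/-- Under detectability, a trajectory of finite cost returns arbitrarily close to the origin at
arbitrarily late times. -/
theorem IsAdmissible.exists_dotProduct_self_lt (hQ : Q.PosSemidef) (hR : R.PosDef)
    (hAQ : IsDetectable A (matrixSqrt Q)) (h : IsAdmissible A B x₀ u x)
    (hint : IntegrableOn (stageCost Q R u x) (Ioi 0)) {ε τ₀ : ℝ} (hε : 0 < ε) (hτ₀ : 0 ≤ τ₀) :
    ∃ τ, τ₀ ≤ τ ∧ x τ ⬝ᵥ x τ < ε := by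
  by_contra! hcon
  obtain ⟨S, hS, c, hc, hst⟩ := hAQ.exists_storage (B := B) hQ hR
  set J := ∫ t in Ioi 0, stageCost Q R u x t with hJ
  set V₀ := x 0 ⬝ᵥ S *ᵥ x 0 with hV₀
  -- Integrating the storage inequality bounds half of ∫|x|² by V₀ + cJ, whereas |x|² ≥ ε after τ₀
  -- makes this integral grow linearly.
  have hbound : ∀ τ, τ₀ ≤ τ → ε * (τ - τ₀) ≤ 2 * (V₀ + c * J) := by
    intro τ hτ
    have hτ0 : 0 ≤ τ := hτ₀.trans hτ
    have htraj := h.2 τ hτ0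
    have hxx : ContinuousOn (fun s => x s ⬝ᵥ x s) (Icc 0 τ) :=
      (continuous_id.dotProduct continuous_id).comp_continuousOn htraj.continuousOn_state
    have hxxi : ∀ a ∈ Icc 0 τ, ∀ b ∈ Icc 0 τ,
        IntervalIntegrable (fun s => x s ⬝ᵥ x s) volume a b := fun a ha b hb =>
      (hxx.mono (uIcc_subset_Icc ha hb)).intervalIntegrable
    have h0 : (0 : ℝ) ∈ Icc 0 τ := ⟨le_rfl, hτ0⟩
    have hm : τ₀ ∈ Icc 0 τ := ⟨hτ₀, hτ⟩
    have hττ : τ ∈ Icc 0 τ := ⟨hτ0, le_rfl⟩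
    have hci := intervalIntegrable_of_integrableOn_Ioi hint le_rfl hτ0
    have h1 := htraj.quadraticForm_sub hτ0 (isSymm_of_posSemidef hS)
    have h2 : (∫ s in (0 : ℝ)..τ, 2 * (S *ᵥ x s ⬝ᵥ (A *ᵥ x s + B *ᵥ u s))) ≤
        ∫ s in (0 : ℝ)..τ, (-(1 / 2) * (x s ⬝ᵥ x s) + c * stageCost Q R u x s) :=
      intervalIntegral.integral_mono_on hτ0 (htraj.intervalIntegrable_quadraticForm hτ0 S)
        (((hxxi 0 h0 τ hττ).const_mul _).add (hci.const_mul _)) fun s _ => hst (x s) (u s)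
    rw [← h1, intervalIntegral.integral_add ((hxxi 0 h0 τ hττ).const_mul _) (hci.const_mul _),
      intervalIntegral.integral_const_mul, intervalIntegral.integral_const_mul] at h2
    have h3 : c * ∫ s in (0 : ℝ)..τ, stageCost Q R u x s ≤ c * J :=
      mul_le_mul_of_nonneg_left
        (intervalIntegral_le_integral_Ioi hint (stageCost_nonneg hQ hR) hτ0) hc
    have h4 : ε * (τ - τ₀) ≤ ∫ s in τ₀..τ, x s ⬝ᵥ x s := by
      have := intervalIntegral.integral_mono_on hτ (f := fun _ => ε) intervalIntegrable_const
        (hxxi τ₀ hm τ hττ) fun s hs => hcon s hs.1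
      rw [intervalIntegral.integral_const, smul_eq_mul] at this
      linarith
    have h5 : 0 ≤ ∫ s in (0 : ℝ)..τ₀, x s ⬝ᵥ x s :=
      intervalIntegral.integral_nonneg hτ₀ fun s _ => dotProduct_self_nonneg_real (x s)
    have h6 := intervalIntegral.integral_add_adjacent_intervals (hxxi 0 h0 τ₀ hm)
      (hxxi τ₀ hm τ hττ)
    have h7 := quadraticForm_nonneg hS (x τ)
    linarith
  have hb0 : 0 ≤ 2 * (V₀ + c * J) := by
    have := hbound τ₀ le_rfl
    rwa [sub_self, mul_zero] at this
  have := hbound (τ₀ + (2 * (V₀ + c * J) + 1) / ε) (by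
    have : 0 ≤ (2 * (V₀ + c * J) + 1) / ε := by positivity
    linarith)
  rw [add_sub_cancel_left, mul_div_cancel₀ _ hε.ne'] at this
  linarith

theorem IsAdmissible.exists_quadraticForm_lt (hQ : Q.PosSemidef) (hR : R.PosDef)
    (hAQ : IsDetectable A (matrixSqrt Q)) (hP : P.PosSemidef) (h : IsAdmissible A B x₀ u x)
    (hint : IntegrableOn (stageCost Q R u x) (Ioi 0)) {ε τ₀ : ℝ} (hε : 0 < ε) (hτ₀ : 0 ≤ τ₀) :
    ∃ τ, τ₀ ≤ τ ∧ x τ ⬝ᵥ P *ᵥ x τ < ε := by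
  obtain ⟨c, hc, hcP⟩ := exists_mulVec_dotProduct_self_le (matrixSqrt P)
  have hc1 : 0 < c + 1 := by linarith
  obtain ⟨τ, hτ, hlt⟩ := h.exists_dotProduct_self_lt hQ hR hAQ hint (div_pos hε hc1) hτ₀
  refine ⟨τ, hτ, ?_⟩
  have h1 := hcP (x τ)
  rw [matrixSqrt_mulVec_dotProduct_self hP] at h1
  rw [lt_div_iff₀ hc1] at hlt
  have := dotProduct_self_nonneg_real (x τ)
  linarith

theorem feedback_residual_eq_stageCost_add (hP : P.IsSymm) (hR : R.IsSymm)
    (hK : R * K = Bᵀ * P) (hric : Q + P * A + Aᵀ * P = P * B * K) (s : ℝ) :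
    (u s + K *ᵥ x s) ⬝ᵥ R *ᵥ (u s + K *ᵥ x s) =
      stageCost Q R u x s + 2 * (P *ᵥ x s ⬝ᵥ (A *ᵥ x s + B *ᵥ u s)) :=
  (completion_of_squares hP hR hK hric (x s) (u s)).symm

/-- Completion of squares, integrated. Integrability of the running cost has to be assumed, because
a locally integrable input need not be square integrable. -/
theorem IsAdmissible.integral_stageCost (hP : P.IsSymm) (hR : R.IsSymm) (hK : R * K = Bᵀ * P)
    (hric : Q + P * A + Aᵀ * P = P * B * K) (h : IsAdmissible A B x₀ u x) {τ : ℝ} (hτ : 0 ≤ τ)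
    (hint : IntervalIntegrable (stageCost Q R u x) volume 0 τ) :
    IntervalIntegrable (fun s => (u s + K *ᵥ x s) ⬝ᵥ R *ᵥ (u s + K *ᵥ x s)) volume 0 τ ∧
    ∫ s in (0 : ℝ)..τ, stageCost Q R u x s = x₀ ⬝ᵥ P *ᵥ x₀ - x τ ⬝ᵥ P *ᵥ x τ +
      ∫ s in (0 : ℝ)..τ, (u s + K *ᵥ x s) ⬝ᵥ R *ᵥ (u s + K *ᵥ x s) := by
  have htraj := h.2 τ hτ
  have hq := htraj.intervalIntegrable_quadraticForm hτ P
  simp_rw [feedback_residual_eq_stageCost_add (A := A) hP hR hK hric]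
  refine ⟨hint.add hq, ?_⟩
  rw [intervalIntegral.integral_add hint hq, ← htraj.quadraticForm_sub hτ hP, h.1]
  ring

/-- The cost of any input is at least the value of the Riccati solution. -/
theorem IsAdmissible.value_le (hQ : Q.PosSemidef) (hR : R.PosDef)
    (hAQ : IsDetectable A (matrixSqrt Q)) (hP : P.PosSemidef) (hK : R * K = Bᵀ * P)
    (hric : Q + P * A + Aᵀ * P = P * B * K) (h : IsAdmissible A B x₀ u x)
    (hint : IntegrableOn (stageCost Q R u x) (Ioi 0)) :
    x₀ ⬝ᵥ P *ᵥ x₀ ≤ ∫ t in Ioi 0, stageCost Q R u x t := by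
  by_contra! hcon
  -- One time at which the terminal term is below the supposed gap is enough; convergence of the
  -- state is not needed.
  obtain ⟨τ, hτ, hlt⟩ := h.exists_quadraticForm_lt hQ hR hAQ hP hint (sub_pos.mpr hcon) le_rfl
  obtain ⟨-, heq⟩ := h.integral_stageCost (isSymm_of_posSemidef hP)
    (isSymm_of_posSemidef hR.posSemidef) hK hric hτ
    (intervalIntegrable_of_integrableOn_Ioi hint le_rfl hτ)
  have h1 := intervalIntegral_le_integral_Ioi hint (stageCost_nonneg hQ hR) hτ
  have h2 : 0 ≤ ∫ s in (0 : ℝ)..τ, (u s + K *ᵥ x s) ⬝ᵥ R *ᵥ (u s + K *ᵥ x s) :=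
    intervalIntegral.integral_nonneg hτ fun s _ => quadraticForm_nonneg hR.posSemidef _
  linarith

/-- An input whose cost does not exceed the value of the Riccati solution is the feedback. -/
theorem IsAdmissible.ae_eq_feedback (hQ : Q.PosSemidef) (hR : R.PosDef)
    (hAQ : IsDetectable A (matrixSqrt Q)) (hP : P.PosSemidef) (hK : R * K = Bᵀ * P)
    (hric : Q + P * A + Aᵀ * P = P * B * K) (h : IsAdmissible A B x₀ u x)
    (hint : IntegrableOn (stageCost Q R u x) (Ioi 0))
    (hle : ∫ t in Ioi 0, stageCost Q R u x t ≤ x₀ ⬝ᵥ P *ᵥ x₀) :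
    u =ᵐ[volume.restrict (Ioi (0 : ℝ))] fun t => -K *ᵥ x t := by
  set w : ℝ → ℝ := fun s => (u s + K *ᵥ x s) ⬝ᵥ R *ᵥ (u s + K *ᵥ x s) with hw
  have hwnn : ∀ s, 0 ≤ w s := fun s => quadraticForm_nonneg hR.posSemidef _
  have hsq := fun (τ : ℝ) (hτ : 0 ≤ τ) => h.integral_stageCost (isSymm_of_posSemidef hP)
    (isSymm_of_posSemidef hR.posSemidef) hK hric hτ
    (intervalIntegrable_of_integrableOn_Ioi hint le_rfl hτ)
  -- The residual on [0, k] is at most that on a longer [0, τ], which by `hle` does not exceed the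
  -- terminal term x(τ)ᵀPx(τ) < ε.
  have hzero : ∀ k : ℕ, ∫ s in (0 : ℝ)..k, w s = 0 := by
    intro k
    refine le_antisymm (le_of_forall_pos_lt_add fun ε hε => ?_)
      (intervalIntegral.integral_nonneg k.cast_nonneg fun s _ => hwnn s)
    obtain ⟨τ, hτ, hlt⟩ := h.exists_quadraticForm_lt hQ hR hAQ hP hint hε k.cast_nonneg
    have hτ0 : 0 ≤ τ := k.cast_nonneg.trans hτ
    obtain ⟨hwi, heq⟩ := hsq τ hτ0
    have h1 := intervalIntegral_le_integral_Ioi hint (stageCost_nonneg hQ hR) hτ0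
    have h2 : ∫ s in (0 : ℝ)..k, w s ≤ ∫ s in (0 : ℝ)..τ, w s :=
      intervalIntegral.integral_mono_interval le_rfl k.cast_nonneg hτ
        (Eventually.of_forall hwnn) hwi
    have h3 : ∫ s in (0 : ℝ)..τ, w s =
      ∫ s in (0 : ℝ)..τ, (u s + K *ᵥ x s) ⬝ᵥ R *ᵥ (u s + K *ᵥ x s) := rfl
    linarith
  have hae : ∀ k : ℕ, ∀ᵐ s ∂volume.restrict (Ioc (0 : ℝ) k), w s = 0 := by
    intro k
    have hi := (hsq k k.cast_nonneg).1
    rw [intervalIntegrable_iff_integrableOn_Ioc_of_le k.cast_nonneg] at hi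
    have hz := hzero k
    rw [intervalIntegral.integral_of_le k.cast_nonneg] at hz
    exact (setIntegral_eq_zero_iff_of_nonneg_ae (Eventually.of_forall hwnn) hi).mp hz
  have hIoi : (Ioi (0 : ℝ)) = ⋃ k : ℕ, Ioc (0 : ℝ) k := by
    ext t
    simp only [mem_Ioi, mem_iUnion, mem_Ioc, exists_and_left, iff_self_and]
    exact fun _ => exists_nat_ge t
  have hall : ∀ᵐ s ∂volume.restrict (Ioi (0 : ℝ)), w s = 0 := by
    rw [hIoi, ae_restrict_iUnion_iff]
    exact hae
  filter_upwards [hall] with s hs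
  have : u s + K *ᵥ x s = 0 := by
    by_contra hne
    have := hR.dotProduct_mulVec_pos hne
    rw [star_trivial] at this
    exact this.ne' hs
  rw [Matrix.neg_mulVec]
  exact eq_neg_of_add_eq_zero_left this

end Cost

/-! ### The closed loop: optimality and uniqueness. -/

section ClosedLoop

open Matrix Set MeasureTheory Filter Topology

variable {n m : ℕ} {A Q P : Matrix (Fin n) (Fin n) ℝ} {B : Matrix (Fin n) (Fin m) ℝ}
  {R : Matrix (Fin m) (Fin m) ℝ} {K : Matrix (Fin m) (Fin n) ℝ} {x₀ : Fin n → ℝ}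
  {u : ℝ → Fin m → ℝ} {x : ℝ → Fin n → ℝ}

/-- The closed-loop state `exp (t (A - B K)) x₀`. -/
noncomputable def closedLoop (A : Matrix (Fin n) (Fin n) ℝ) (B : Matrix (Fin n) (Fin m) ℝ)
    (K : Matrix (Fin m) (Fin n) ℝ) (x₀ : Fin n → ℝ) (t : ℝ) : Fin n → ℝ :=
  NormedSpace.exp (t • (A - B * K)) *ᵥ x₀

theorem hasDerivAt_closedLoop (t : ℝ) :
    HasDerivAt (closedLoop A B K x₀) ((A - B * K) *ᵥ closedLoop A B K x₀ t) t :=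
  hasDerivAt_exp_smul_mulVec (A - B * K) x₀ t

theorem continuous_closedLoop : Continuous (closedLoop A B K x₀) :=
  continuous_iff_continuousAt.mpr fun t => (hasDerivAt_closedLoop t).continuousAt

theorem sub_mul_mulVec (v : Fin n → ℝ) : (A - B * K) *ᵥ v = A *ᵥ v + B *ᵥ (-K *ᵥ v) := by
  rw [Matrix.sub_mulVec, Matrix.neg_mulVec, Matrix.mulVec_neg, Matrix.mulVec_mulVec, sub_eq_add_neg]

theorem isAdmissible_closedLoop : IsAdmissible A B x₀ (fun t => -K *ᵥ closedLoop A B K x₀ t)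
    (closedLoop A B K x₀) := by
  have hc : Continuous fun t => -K *ᵥ closedLoop A B K x₀ t :=
    (continuous_mulVec (-K)).comp continuous_closedLoop
  refine ⟨by simp [closedLoop], fun τ _ => ⟨hc.integrableOn_Icc,
    continuous_closedLoop.continuousOn, fun t _ => ?_⟩⟩
  have := intervalIntegral.integral_eq_sub_of_hasDerivAt (a := 0) (b := t)
    (fun s _ => hasDerivAt_closedLoop (A := A) (B := B) (K := K) (x₀ := x₀) s)
    (((continuous_mulVec (A - B * K)).comp continuous_closedLoop).intervalIntegrable 0 t)
  simp_rw [sub_mul_mulVec] at this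
  rw [this, add_sub_cancel]

/-- The integral equation sees the input only up to null sets. After replacing it by the feedback
the integrand is continuous, so the state solves the closed-loop equation classically. -/
theorem IsAdmissible.eq_closedLoop (h : IsAdmissible A B x₀ u x)
    (hu : u =ᵐ[volume.restrict (Ioi (0 : ℝ))] fun t => -K *ᵥ x t) {t : ℝ} (ht : 0 ≤ t) :
    x t = closedLoop A B K x₀ t := by
  have htraj := h.2 t ht
  have hderiv : ∀ s ∈ Icc 0 t, HasDerivWithinAt x ((A - B * K) *ᵥ x s) (Icc 0 t) s := by
    refine fun s hs => hasDerivWithinAt_of_eq_integral (f := fun s => (A - B * K) *ᵥ x s)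
      ((continuous_mulVec _).comp_continuousOn htraj.continuousOn_state) (fun r hr => ?_) hs
    rw [htraj.state_eq r hr]
    congr 1
    refine intervalIntegral.integral_congr_ae ?_
    rw [EventuallyEq, ae_restrict_iff' measurableSet_Ioi] at hu
    filter_upwards [hu] with q hq hqr
    rw [uIoc_of_le hr.1] at hqr
    rw [hq hqr.1, sub_mul_mulVec]
  have := eq_exp_smul_mulVec hderiv (right_mem_Icc.mpr ht)
  rwa [sub_zero, h.1] at this

/-- Along the feedback the residual is zero, so dropping the nonnegative terminal term bounds every
partial cost. Since the running cost is nonnegative, this already gives integrability, without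
stability of the closed loop. -/
theorem closedLoop_cost (hQ : Q.PosSemidef) (hR : R.PosDef) (hP : P.PosSemidef)
    (hK : R * K = Bᵀ * P) (hric : Q + P * A + Aᵀ * P = P * B * K) :
    IntegrableOn (stageCost Q R (fun t => -K *ᵥ closedLoop A B K x₀ t) (closedLoop A B K x₀))
      (Ioi 0) ∧
    ∫ t in Ioi 0, stageCost Q R (fun t => -K *ᵥ closedLoop A B K x₀ t) (closedLoop A B K x₀) t ≤
      x₀ ⬝ᵥ P *ᵥ x₀ := by
  set r := stageCost Q R (fun t => -K *ᵥ closedLoop A B K x₀ t) (closedLoop A B K x₀) with hr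
  have hxc : Continuous (closedLoop A B K x₀) := continuous_closedLoop
  have huc : Continuous fun t => -K *ᵥ closedLoop A B K x₀ t := (continuous_mulVec (-K)).comp hxc
  have hrc : Continuous r :=
    (hxc.dotProduct ((continuous_mulVec Q).comp hxc)).add
      (huc.dotProduct ((continuous_mulVec R).comp huc))
  have hle : ∀ τ : ℝ, 0 ≤ τ → ∫ s in (0 : ℝ)..τ, r s ≤ x₀ ⬝ᵥ P *ᵥ x₀ := by
    intro τ hτ
    have h := (isAdmissible_closedLoop (A := A) (B := B) (K := K) (x₀ := x₀)).integral_stageCost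
      (isSymm_of_posSemidef hP) (isSymm_of_posSemidef hR.posSemidef) hK hric hτ
      (hrc.intervalIntegrable 0 τ)
    have h1 := quadraticForm_nonneg hP (closedLoop A B K x₀ τ)
    have h2 := h.2
    simp only [Matrix.neg_mulVec, neg_add_cancel, Matrix.mulVec_zero, dotProduct_zero,
      intervalIntegral.integral_zero, add_zero] at h2
    simp only [hr, Matrix.neg_mulVec]
    linarith
  have hint : IntegrableOn r (Ioi 0) := by
    refine integrableOn_Ioi_of_intervalIntegral_norm_bounded (l := atTop) (b := id)
      (x₀ ⬝ᵥ P *ᵥ x₀) 0 (fun τ => hrc.integrableOn_Ioc) tendsto_id ?_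
    filter_upwards [eventually_ge_atTop 0] with τ hτ
    refine le_trans (le_of_eq ?_) (hle τ hτ)
    exact intervalIntegral.integral_congr fun s _ =>
      Real.norm_of_nonneg (stageCost_nonneg hQ hR s)
  refine ⟨hint, le_of_tendsto (intervalIntegral_tendsto_integral_Ioi 0 hint tendsto_id) ?_⟩
  filter_upwards [eventually_ge_atTop 0] with τ hτ using hle τ hτ

/-- The gain of a positive semidefinite solution of the algebraic Riccati equation is the unique
solution of the LQR problem. -/
theorem isUniqueLQRSolution_of_riccati (hQ : Q.PosSemidef) (hR : R.PosDef)
    (hAQ : IsDetectable A (matrixSqrt Q)) (hP : P.PosSemidef) (hK : R * K = Bᵀ * P)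
    (hric : Q + P * A + Aᵀ * P = P * B * K) : IsUniqueLQRSolution A B Q R K := by
  have hopt : ∀ x₀, IsOptimal A B Q R x₀ (fun t => -K.mulVec (closedLoop A B K x₀ t))
      (closedLoop A B K x₀) := by
    intro x₀
    simp_rw [← Matrix.neg_mulVec]
    obtain ⟨hint, hle⟩ := closedLoop_cost (x₀ := x₀) hQ hR hP hK hric
    have hcost := lqrCost_eq_ofReal hQ hR hint
    refine ⟨isAdmissible_closedLoop, hcost ▸ ENNReal.ofReal_lt_top, fun u' x' h' => ?_⟩
    by_cases hfin : lqrCost Q R u' x' < ∞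
    · have hint' := h'.integrableOn_stageCost hQ hR hfin
      rw [hcost, lqrCost_eq_ofReal hQ hR hint']
      exact ENNReal.ofReal_le_ofReal (hle.trans (h'.value_le hQ hR hAQ hP hK hric hint'))
    · rw [not_lt_top_iff.mp hfin]
      exact le_top
  have huniq : ∀ x₀ u' x', IsOptimal A B Q R x₀ u' x' →
      (∀ t : ℝ, 0 ≤ t → x' t = closedLoop A B K x₀ t) ∧
      u' =ᵐ[volume.restrict (Ioi (0 : ℝ))] fun t => -K.mulVec (closedLoop A B K x₀ t) := by
    intro x₀ u' x' ⟨hadm, hfin, hmin⟩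
    obtain ⟨hint, hle⟩ := closedLoop_cost (x₀ := x₀) hQ hR hP hK hric
    have hint' := hadm.integrableOn_stageCost hQ hR hfin
    have hcmp := hmin _ _ (isAdmissible_closedLoop (A := A) (B := B) (K := K) (x₀ := x₀))
    rw [lqrCost_eq_ofReal hQ hR hint, lqrCost_eq_ofReal hQ hR hint', ENNReal.ofReal_le_ofReal_iff
      (integral_nonneg fun t => stageCost_nonneg hQ hR t)] at hcmp
    have hfb := hadm.ae_eq_feedback hQ hR hAQ hP hK hric hint' (hcmp.trans hle)
    have hx := fun (t : ℝ) (ht : 0 ≤ t) => hadm.eq_closedLoop hfb ht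
    refine ⟨hx, ?_⟩
    filter_upwards [hfb, ae_restrict_mem measurableSet_Ioi] with t ht ht0
    rw [ht, hx t (le_of_lt ht0), Matrix.neg_mulVec]
  refine ⟨fun x₀ => ⟨closedLoop A B K x₀, hopt x₀, huniq x₀⟩, fun K' hK' => ?_⟩
  refine Matrix.ext_of_mulVec_single fun i => ?_
  set x₀ : Fin n → ℝ := Pi.single i 1
  obtain ⟨x', hx'⟩ := hK' x₀
  obtain ⟨hx, hu⟩ := huniq x₀ _ x' hx'
  have hae : (fun t => K' *ᵥ closedLoop A B K x₀ t) =ᵐ[volume.restrict (Ioi (0 : ℝ))]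
      fun t => K *ᵥ closedLoop A B K x₀ t := by
    filter_upwards [hu, ae_restrict_mem measurableSet_Ioi] with t ht ht0
    rw [hx t (le_of_lt ht0)] at ht
    exact neg_injective ht
  have hc' : Continuous fun t => K' *ᵥ closedLoop A B K x₀ t :=
    (continuous_mulVec K').comp continuous_closedLoop
  have hc : Continuous fun t => K *ᵥ closedLoop A B K x₀ t :=
    (continuous_mulVec K).comp continuous_closedLoop
  -- Continuity upgrades almost everywhere equality on t > 0 to equality at t = 0, where the state
  -- is the chosen basis vector; this compares the two gains column by column.
  have heq := (Measure.eqOn_open_of_ae_eq hae isOpen_Ioi hc'.continuousOn hc.continuousOn).closure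
    hc' hc
  have h0 := heq (x := 0) (by rw [closure_Ioi]; exact self_mem_Ici)
  simpa [closedLoop] using h0

end ClosedLoop

end DataLQR

theorem theorem5 {n m N : ℕ}
    (A : Matrix (Fin n) (Fin n) ℝ) (B : Matrix (Fin n) (Fin m) ℝ)
    (Q : Matrix (Fin n) (Fin n) ℝ) (R : Matrix (Fin m) (Fin m) ℝ)
    (hQ : Q.PosSemidef) (hR : R.PosDef)
    (hAB : DataLQR.IsControllable A B)
    (hAQ : DataLQR.IsDetectable A (DataLQR.matrixSqrt Q))
    (T : ℝ) (u : ℝ → Fin m → ℝ) (x : ℝ → Fin n → ℝ)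
    (hu : DataLQR.IsPCPE A T N (n + 1) u)
    (hx : DataLQR.IsTrajectoryOn A B (N * T) u x)
    (t : ℝ) (ht : t ∈ Set.Icc 0 T)
    (P : Matrix (Fin n) (Fin n) ℝ)
    (hP : DataLQR.IsTraceMaximizer Q R T N u x t P)
    (Γ : Matrix (Fin N) (Fin n) ℝ)
    (hΓ : Matrix.fromRows (DataLQR.hankelRow T N x t) (DataLQR.dataLMI Q R T N u x t P) * Γ
      = Matrix.fromRows 1 0) :
    DataLQR.IsUniqueLQRSolution A B Q R (-(DataLQR.inputData T N u * Γ)) := by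
  rw [Matrix.fromRows_mul] at hΓ
  obtain ⟨h1, h2⟩ := (Matrix.fromRows_ext_iff _ _ _ _).mp hΓ
  obtain ⟨hK, hric⟩ := DataLQR.riccati_of_data hAB hu hx ht h1 h2
  refine DataLQR.isUniqueLQRSolution_of_riccati hQ hR hAQ hP.1.1.posSemidef ?_ ?_
  · rw [Matrix.mul_neg]
    exact neg_eq_of_add_eq_zero_right hK
  · rw [Matrix.mul_neg, eq_neg_iff_add_eq_zero, ← hric, Matrix.mul_add, Matrix.mul_assoc]
    abel
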